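/- Work in the polar-coordinate model of the hyperbolic plane $\mathbb{H}^2$ with pole $O$: a point $P$ has radius $r(P)$ and angle $\varphi(P)$, the pole lies on every ray from $O$, and $$|AB| = \operatorname{arcosh}\bigl(\cosh r(A)\cosh r(B) - \sinh r(A)\sinh r(B)\cos(\varphi(A)-\varphi(B))\bigr).$$ Let $\mathcal{S}\subset\mathbb{H}^2$ be a finite set of sites. A point $V$ is a Voronoi vertex if at least three sites are closest to $V$; these are the sites incident to $V$. The circle around $V$ through them is its witness circle, and its far point $V'$ is a point of this circle with the largest radius. For a sweep radius $\hat r$ let $\mathcal{S}_{\le \hat r}=\{S\in\mathcal{S} : r(S)\le \hat r\}$. The beach ellipse of $S\in\mathcal{S}_{\le \hat r}$ is $E_{\hat r}(S)=\{P : |PS| = \hat r - r(P)\}$. Its active part $A_{\hat r}(S)$ consists of those $P\in E_{\hat r}(S)$ for which there are no $S'\in\mathcal{S}_{\le \hat r}$ and $P'\in E_{\hat r}(S')$ on the same ray from $O$ as $P$ with $r(P)<r(P')$. The beach curve is $\mathcal{B}_{\hat r}=\bigcup_{S\in\mathcal{S}_{\le \hat r}} A_{\hat r}(S)$, and an active segment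 of $S$ at $\hat r$ is a connected component of $A_{\hat r}(S)$. A moving active segment of $S$ on an interval $J$ of radii is a family $(C_{\hat r})_{\hat r\in J}$, continuous with respect to the Hausdorff distance, of active segments of $S$. Let $J$ be non-empty with supremum $r<\infty$ (where $r\in J$ or $r\notin J$, and $J=\{r\}$ is allowed). The moving segment becomes inactive at $r$ if there are no $a\in J$, $\varepsilon>0$ and continuous $\gamma\colon[a,r+\varepsilon]\to\mathbb{H}^2$ with $\gamma(\hat r)\in C_{\hat r}$ for all $\hat r\in J$ with $\hat r\ge a$ and $\gamma(\hat r)\in A_{\hat r}(S)$ for all $\hat r\in[r,r+\varepsilon]$. (1) An active beach-ellipse segment can become inactive only through a circle event: if a moving active segment $(C_{\hat r})_{\hat r\in J}$ of $S$ becomes inactive at $r$, then there is a Voronoi vertex $V$, incident to $S$, with far point $V'$ such that $r=r(V')$ and the segment shrinks to $V$, i.e. $\sup_{P\in C_{\hat r}}|PV|\to 0$ as $\hat r\to r$ in $J$ (if $r \in J$, this includes $C_r=\{V\}$). (2) Let $r_i<r_j$ be consecutive elements of $\{0,\infty\}\cup\{r(S) : S\in\mathcal{S}\}\cup\{r(V')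 : V \text{ a Voronoi vertex}\}$ and let $r\in(r_i,r_j)$. Then no beach-ellipse intersection leaves the beach curve at $r$: for distinct $S,T\in\mathcal{S}_{\le r}$ there are no $\varepsilon>0$ and continuous $I\colon[r,r+\varepsilon]\to\mathbb{H}^2$ with $I(\hat r)\in E_{\hat r}(S)\cap E_{\hat r}(T)$ for all $\hat r\in[r,r+\varepsilon]$, $I(r)\in\mathcal{B}_r$, and $I(\hat r)\notin\mathcal{B}_{\hat r}$ for all $\hat r\in(r,r+\varepsilon]$. -/

import Mathlib

open Set Filter Topology

namespace HyperbolicSweep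

noncomputable section

/-- The hyperbolic plane in the polar-coordinate model: a complex number `z` stands for the point
whose polar coordinates (radius and angle around the pole) are `‖z‖` and `Complex.arg z`.
The topology of `ℂ` is the topology of the hyperbolic plane in these coordinates; the hyperbolic
metric is `hdist` below, and the Euclidean metric of `ℂ` is not used. -/
abbrev HPlane : Type := ℂ

/-- The radial coordinate: the hyperbolic distance to the pole. -/
def radius (P : HPlane) : ℝ := ‖P‖

/-- The angular coordinate, up to multiples of `2π`. -/
def angle (P : HPlane) : ℝ := Complex.arg P

/-- The hyperbolic distance of two points. -/
def hdist (A B : HPlane) : ℝ :=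
  Real.arcosh (Real.cosh (radius A) * Real.cosh (radius B) -
    Real.sinh (radius A) * Real.sinh (radius B) * Real.cos (angle A - angle B))

/-- Two points lie on a common ray from the pole. The pole has no angle of its own and
lies on every ray. -/
def SameAngle (P Q : HPlane) : Prop := P = 0 ∨ Q = 0 ∨ angle P = angle Q

/-! ### Voronoi vertices -/

/-- `S` is a site, and no site is closer to `V` than `S`. -/
def IsClosestSite (𝒮 : Finset HPlane) (V S : HPlane) : Prop :=
  S ∈ 𝒮 ∧ ∀ T ∈ 𝒮, hdist V S ≤ hdist V T

/-- `V` has (at least) three closest sites, i.e. it is the center of a circle with no site in its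
interior and at least three sites on its arc. -/
def IsVoronoiVertex (𝒮 : Finset HPlane) (V : HPlane) : Prop :=
  ∃ S₁ S₂ S₃ : HPlane, S₁ ≠ S₂ ∧ S₁ ≠ S₃ ∧ S₂ ≠ S₃ ∧
    IsClosestSite 𝒮 V S₁ ∧ IsClosestSite 𝒮 V S₂ ∧ IsClosestSite 𝒮 V S₃

/-- The circle around `V` through the sites closest to `V`. -/
def witnessCircle (𝒮 : Finset HPlane) (V : HPlane) : Set HPlane :=
  {Q | ∃ S, IsClosestSite 𝒮 V S ∧ hdist V Q = hdist V S}

/-- `V'` is a point of the witness circle of `V` with the largest radial coordinate. -/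
def IsFarPoint (𝒮 : Finset HPlane) (V V' : HPlane) : Prop :=
  V' ∈ witnessCircle 𝒮 V ∧ ∀ Q ∈ witnessCircle 𝒮 V, radius Q ≤ radius V'

/-! ### Beach ellipses and the beach curve -/

/-- The sites contained in the sweep circle of radius `R`. -/
def seenSites (𝒮 : Finset HPlane) (R : ℝ) : Set HPlane := {S | S ∈ 𝒮 ∧ radius S ≤ R}

/-- The points at equal distance to `S` and to the sweep circle of radius `R`; a point `P` of
radius at most `R` has distance `R - radius P` to the sweep circle. -/
def beachEllipse (S : HPlane) (R : ℝ) : Set HPlane := {P | hdist P S = R - radius P}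

/-- The active part of the beach ellipse of `S` when the sweep circle has radius `R`. -/
def activePart (𝒮 : Finset HPlane) (S : HPlane) (R : ℝ) : Set HPlane :=
  {P | S ∈ seenSites 𝒮 R ∧ P ∈ beachEllipse S R ∧
    ¬ ∃ S' ∈ seenSites 𝒮 R, ∃ P' ∈ beachEllipse S' R, SameAngle P P' ∧ radius P < radius P'}

/-- The beach curve when the sweep circle has radius `R`. -/
def beachCurve (𝒮 : Finset HPlane) (R : ℝ) : Set HPlane :=
  ⋃ S ∈ seenSites 𝒮 R, activePart 𝒮 S R

/-- `C` is an active segment of (the beach ellipse of) `S` at sweep radius `R`: a connected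
component of the active part. -/
def IsActiveSegment (𝒮 : Finset HPlane) (S : HPlane) (R : ℝ) (C : Set HPlane) : Prop :=
  ∃ P ∈ activePart 𝒮 S R, C = connectedComponentIn (activePart 𝒮 S R) P

/-! ### Events -/

/-- The radii of the true circle events. -/
def circleEvents (𝒮 : Finset HPlane) : Set ℝ :=
  {r | ∃ V V', IsVoronoiVertex 𝒮 V ∧ IsFarPoint 𝒮 V V' ∧ radius V' = r}

/-- The radii of the site events. -/
def siteEvents (𝒮 : Finset HPlane) : Set ℝ := {r | ∃ S ∈ 𝒮, radius S = r}

/-- The site events and the true circle events, together with the two end marks `0` and `∞`. -/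
def events (𝒮 : Finset HPlane) : Set EReal :=
  {0, ⊤} ∪ (fun r : ℝ => (r : EReal)) '' (siteEvents 𝒮 ∪ circleEvents 𝒮)

/-- `a < b` are consecutive events. -/
def ConsecutiveEvents (𝒮 : Finset HPlane) (a b : EReal) : Prop :=
  a ∈ events 𝒮 ∧ b ∈ events 𝒮 ∧ a < b ∧ ∀ c ∈ events 𝒮, ¬ (a < c ∧ c < b)

/-! ### Leaving the beach curve -/

/-- `I` is an intersection of the beach ellipses of `S` and `T` that moves (continuously) with the
sweep radius; it is on the beach curve at radius `r` but not on it right after `r`. -/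
def LeavesBeachCurveAt (𝒮 : Finset HPlane) (S T : HPlane) (I : ℝ → HPlane) (r : ℝ) : Prop :=
  ∃ ε > 0, ContinuousOn I (Icc r (r + ε)) ∧
    (∀ R ∈ Icc r (r + ε), I R ∈ beachEllipse S R ∩ beachEllipse T R) ∧
    I r ∈ beachCurve 𝒮 r ∧ ∀ R ∈ Ioc r (r + ε), I R ∉ beachCurve 𝒮 R

/-- For `R ∈ J`, `C R` is an active segment of `S` that moves continuously with `R`, with respect
to the Hausdorff distance of sets. -/
def IsMovingSegment (𝒮 : Finset HPlane) (S : HPlane) (J : Set ℝ) (C : ℝ → Set HPlane) : Prop :=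
  (∀ R ∈ J, IsActiveSegment 𝒮 S R (C R)) ∧
  ∀ R₀ ∈ J, ∀ δ > 0, ∀ᶠ R in 𝓝[J] R₀,
    (∀ P ∈ C R, ∃ Q ∈ C R₀, hdist P Q < δ) ∧ (∀ Q ∈ C R₀, ∃ P ∈ C R, hdist P Q < δ)

/-- The moving segment `C` of `S`, given for the radii in `J` (which end at `r`), is still active
after `r`, possibly split by other segments: some point that moves continuously with the sweep
radius lies on the segment before `r`, and stays in the active part of `S` for a while after `r`. -/
def RemainsActiveBeyond (𝒮 : Finset HPlane) (S : HPlane) (J : Set ℝ) (C : ℝ → Set HPlane)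
    (r : ℝ) : Prop :=
  ∃ a ∈ J, ∃ ε > 0, ∃ γ : ℝ → HPlane, ContinuousOn γ (Icc a (r + ε)) ∧
    (∀ R ∈ J, a ≤ R → γ R ∈ C R) ∧ ∀ R ∈ Icc r (r + ε), γ R ∈ activePart 𝒮 S R

/-- An active segment `C` of `S`, followed over an interval `J` of radii that ends at `r`, becomes
inactive at `r`. Both `r ∈ J` (the segment is last active at `r`; in particular `J = {r}`, where no
history is prescribed) and `r ∉ J` (it is active only before `r`) are allowed. -/
def BecomesInactiveAt (𝒮 : Finset HPlane) (S : HPlane) (J : Set ℝ) (C : ℝ → Set HPlane)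
    (r : ℝ) : Prop :=
  J.Nonempty ∧ J.OrdConnected ∧ IsLUB J r ∧ IsMovingSegment 𝒮 S J C ∧
    ¬ RemainsActiveBeyond 𝒮 S J C r

end

end HyperbolicSweep

open HyperbolicSweep

/-!
Over a direction `θ`, the beach ellipse of a site `S` inside the sweep circle has exactly one point,
and that point is active when no site is closer to it than `S` (strictly, for sites on the sweep
circle). Along the ellipse of `S`, the difference between the distances to another site `T` and to
`S` has the sign of a function `excess` that is sinusoidal in `θ`. For distinct sites inside the
sweep circle it has only simple zeros, so near a given direction the active directions form an
interval.

Let a moving segment of `S` end at `r` and accumulate at a point `V`. By continuity `V` lies on the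
ellipse of `S` at `r` and `S` is a closest site of `V`. If `V` is not a Voronoi vertex, then at most
one other site competes at `V`, and there are directions arbitrarily close to `V` that are strictly
closest to `S`. The ellipse point in such a direction lies on the segment before `r` and stays
active after `r`. Hence a segment that becomes inactive accumulates only at Voronoi vertices
incident to `S`. These are isolated on the ellipse, so by connectedness and continuity the segment
shrinks to one of them, and a vertex on the ellipse at `r` has a far point of radius `r`.

For an intersection of two ellipses on the beach curve at a radius that is no event, the two sites
are the only closest ones, and by continuity they remain so.
-/

namespace HyperbolicSweep

open Real

section Metric

variable {P Q A B : HPlane}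

theorem radius_nonneg (P : HPlane) : 0 ≤ radius P := norm_nonneg P

theorem radius_zero : radius 0 = 0 := norm_zero

theorem radius_pos_iff : 0 < radius P ↔ P ≠ 0 := norm_pos_iff

theorem continuous_radius : Continuous radius := continuous_norm

theorem sinh_radius_nonneg (P : HPlane) : 0 ≤ sinh (radius P) :=
  sinh_nonneg_iff.2 (radius_nonneg P)

/-- The component, in the direction `θ`, of the point of the hyperboloid
`z² = 1 + x² + y²` that represents `S`. -/
noncomputable def rayComponent (S : HPlane) (θ : ℝ) : ℝ := sinh (radius S) * cos (θ - angle S)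

theorem abs_rayComponent_le (S : HPlane) (θ : ℝ) : |rayComponent S θ| ≤ sinh (radius S) := by
  rw [rayComponent, abs_mul, abs_of_nonneg (sinh_radius_nonneg S)]
  exact mul_le_of_le_one_right (sinh_radius_nonneg S) (abs_cos_le_one _)

theorem continuous_rayComponent_point (θ : ℝ) : Continuous fun P => rayComponent P θ := by
  rw [continuous_iff_continuousAt]
  intro P
  rcases eq_or_ne P 0 with rfl | hP
  · have hsinh : Tendsto (fun P : HPlane => sinh (radius P)) (𝓝 0) (𝓝 0) := by
      simpa [Function.comp_def, radius_zero] using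
        (continuous_sinh.comp continuous_radius).tendsto 0
    simpa [ContinuousAt, rayComponent, radius_zero] using
      squeeze_zero_norm (fun P => abs_rayComponent_le P θ) hsinh
  · have hnorm : ‖P‖ ≠ 0 := norm_ne_zero_iff.2 hP
    have hcont : ContinuousAt
        (fun P : HPlane => sinh ‖P‖ * (cos θ * (P.re / ‖P‖) + sin θ * (P.im / ‖P‖))) P := by
      fun_prop (disch := assumption)
    refine hcont.congr ?_
    filter_upwards [isOpen_ne.mem_nhds hP] with Q hQ
    simp only [rayComponent, radius, angle, cos_sub, Complex.cos_arg hQ, Complex.sin_arg]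

theorem cosh_law_eq_cosh_sub_add (A B : HPlane) :
    cosh (radius A) * cosh (radius B) - sinh (radius A) * sinh (radius B) * cos (angle A - angle B)
      = cosh (radius A - radius B)
        + sinh (radius A) * sinh (radius B) * (1 - cos (angle A - angle B)) := by
  rw [cosh_sub]
  ring

theorem sinh_mul_sinh_mul_one_sub_cos_nonneg (A B : HPlane) :
    0 ≤ sinh (radius A) * sinh (radius B) * (1 - cos (angle A - angle B)) :=
  mul_nonneg (mul_nonneg (sinh_radius_nonneg A) (sinh_radius_nonneg B))
    (sub_nonneg.2 (cos_le_one _))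

theorem one_le_cosh_law (A B : HPlane) :
    1 ≤ cosh (radius A) * cosh (radius B)
      - sinh (radius A) * sinh (radius B) * cos (angle A - angle B) := by
  rw [cosh_law_eq_cosh_sub_add]
  exact le_add_of_le_of_nonneg (one_le_cosh _) (sinh_mul_sinh_mul_one_sub_cos_nonneg A B)

theorem hdist_nonneg (A B : HPlane) : 0 ≤ hdist A B := arcosh_nonneg (one_le_cosh_law A B)

theorem cosh_hdist (A B : HPlane) :
    cosh (hdist A B) = cosh (radius A) * cosh (radius B)
      - sinh (radius A) * sinh (radius B) * cos (angle A - angle B) :=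
  cosh_arcosh (one_le_cosh_law A B)

theorem cosh_hdist_eq_cosh_sub_add (A B : HPlane) :
    cosh (hdist A B) = cosh (radius A - radius B)
      + sinh (radius A) * sinh (radius B) * (1 - cos (angle A - angle B)) := by
  rw [cosh_hdist, cosh_law_eq_cosh_sub_add]

theorem cosh_hdist_eq_sub_rayComponent (A B : HPlane) :
    cosh (hdist A B) =
      cosh (radius A) * cosh (radius B) - sinh (radius A) * rayComponent B (angle A) := by
  rw [cosh_hdist, rayComponent]
  ring

theorem hdist_comm (A B : HPlane) : hdist A B = hdist B A := by
  rw [hdist, hdist, ← cos_neg, neg_sub]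
  ring_nf

theorem continuous_hdist_left (T : HPlane) : Continuous fun P => hdist P T := by
  have hcosh : Continuous fun P => cosh (hdist T P) := by
    simp_rw [cosh_hdist_eq_sub_rayComponent]
    have := continuous_rayComponent_point (angle T)
    have := continuous_radius
    fun_prop
  have h := continuousOn_arcosh.comp_continuous hcosh fun P => one_le_cosh _
  simpa only [Function.comp_def, arcosh_cosh (hdist_nonneg _ _), hdist_comm T] using h

theorem abs_radius_sub_le_hdist (A B : HPlane) : |radius A - radius B| ≤ hdist A B := by
  rw [← abs_of_nonneg (hdist_nonneg A B), ← cosh_le_cosh, cosh_hdist_eq_cosh_sub_add]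
  exact le_add_of_nonneg_right (sinh_mul_sinh_mul_one_sub_cos_nonneg A B)

theorem cos_angle_sub_eq_one_iff : cos (angle A - angle B) = 1 ↔ angle A = angle B := by
  have hA := Complex.arg_mem_Ioc A
  have hB := Complex.arg_mem_Ioc B
  rw [cos_eq_one_iff_of_lt_of_lt, sub_eq_zero] <;> unfold angle <;>
    linarith [hA.1, hA.2, hB.1, hB.2]

theorem hdist_eq_abs_radius_sub_iff : hdist A B = |radius A - radius B| ↔ SameAngle A B := by
  rw [← cosh_injOn.eq_iff (hdist_nonneg A B) (mem_Ici.2 (abs_nonneg _)), cosh_abs,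
    cosh_hdist_eq_cosh_sub_add, add_eq_left, mul_eq_zero, mul_eq_zero, sinh_eq_zero, sinh_eq_zero,
    sub_eq_zero, eq_comm (a := (1 : ℝ)), cos_angle_sub_eq_one_iff, or_assoc]
  simp only [SameAngle, radius, norm_eq_zero]

theorem hdist_self (P : HPlane) : hdist P P = 0 := by
  rw [hdist_eq_abs_radius_sub_iff.2 (Or.inr (Or.inr rfl)), sub_self, abs_zero]

theorem one_add_sq_div_two_le_cosh (x : ℝ) : 1 + x ^ 2 / 2 ≤ cosh x := by
  have hcosh : cosh x = 1 + 2 * sinh (x / 2) ^ 2 := by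
    have := cosh_two_mul (x / 2)
    rw [mul_div_cancel₀ x two_ne_zero, cosh_sq] at this
    linarith
  have hsinh : (x / 2) ^ 2 ≤ sinh (x / 2) ^ 2 := by
    rw [sq_le_sq, abs_sinh]
    exact self_le_sinh_iff.2 (abs_nonneg _)
  linarith

theorem dist_sq_eq_radius_sub_sq_add (P Q : HPlane) :
    dist P Q ^ 2 = (radius P - radius Q) ^ 2
      + 2 * (radius P * radius Q * (1 - cos (angle P - angle Q))) := by
  have hPQ : dist P Q ^ 2 = (P.re - Q.re) ^ 2 + (P.im - Q.im) ^ 2 := by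
    rw [Complex.dist_eq_re_im, sq_sqrt (by positivity)]
  have hnorm (Z : ℂ) : ‖Z‖ ^ 2 = Z.re ^ 2 + Z.im ^ 2 := by
    rw [← Complex.normSq_eq_norm_sq, Complex.normSq_apply]
    ring
  rw [hPQ, cos_sub, radius, radius, angle, angle]
  linear_combination -hnorm P - hnorm Q
    + 2 * (‖Q‖ * cos Q.arg) * Complex.norm_mul_cos_arg P + 2 * P.re * Complex.norm_mul_cos_arg Q
    + 2 * (‖Q‖ * sin Q.arg) * Complex.norm_mul_sin_arg P + 2 * P.im * Complex.norm_mul_sin_arg Q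

theorem one_add_dist_sq_div_two_le_cosh_hdist (P Q : HPlane) :
    1 + dist P Q ^ 2 / 2 ≤ cosh (hdist P Q) := by
  have hradial := one_add_sq_div_two_le_cosh (radius P - radius Q)
  have hangular : radius P * radius Q * (1 - cos (angle P - angle Q)) ≤
      sinh (radius P) * sinh (radius Q) * (1 - cos (angle P - angle Q)) := by
    gcongr
    · exact sub_nonneg.2 (cos_le_one _)
    · exact radius_nonneg Q
    · exact sinh_radius_nonneg P
    · exact self_le_sinh_iff.2 (radius_nonneg P)
    · exact self_le_sinh_iff.2 (radius_nonneg Q)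
  rw [dist_sq_eq_radius_sub_sq_add, cosh_hdist_eq_cosh_sub_add]
  linarith

theorem exists_hdist_lt_imp_dist_lt {δ : ℝ} (hδ : 0 < δ) :
    ∃ η > 0, ∀ P Q : HPlane, hdist P Q < η → dist P Q < δ := by
  have hlt : 1 < 1 + δ ^ 2 / 2 := lt_add_of_pos_right _ (by positivity)
  refine ⟨arcosh (1 + δ ^ 2 / 2), arcosh_pos hlt, fun P Q hPQ => ?_⟩
  have hcosh : cosh (hdist P Q) < 1 + δ ^ 2 / 2 := by
    rw [← cosh_arcosh hlt.le]
    exact cosh_strictMonoOn (hdist_nonneg P Q) (arcosh_nonneg hlt.le) hPQ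
  have := one_add_dist_sq_div_two_le_cosh_hdist P Q
  exact lt_of_pow_lt_pow_left₀ 2 hδ.le (by linarith)

theorem hdist_eq_zero_iff : hdist P Q = 0 ↔ P = Q := by
  refine ⟨fun h => ?_, fun h => h ▸ hdist_self P⟩
  have := one_add_dist_sq_div_two_le_cosh_hdist P Q
  rw [h, cosh_zero] at this
  exact dist_eq_zero.1 (pow_eq_zero_iff two_ne_zero |>.1 (by nlinarith [sq_nonneg (dist P Q)]))

theorem hdist_pos (h : P ≠ Q) : 0 < hdist P Q :=
  (hdist_nonneg P Q).lt_of_ne fun h0 => h (hdist_eq_zero_iff.1 h0.symm)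

end Metric

section Polar

variable {x : ℝ}

/-- The point with polar coordinates `x` and `θ`, where `θ` is any real number. -/
noncomputable def polar (x θ : ℝ) : HPlane := x * Complex.exp (θ * Complex.I)

theorem continuous_polar : Continuous fun p : ℝ × ℝ => polar p.1 p.2 := by
  unfold polar
  fun_prop

theorem radius_polar (hx : 0 ≤ x) (θ : ℝ) : radius (polar x θ) = x := by
  rw [radius, polar, norm_mul, Complex.norm_exp_ofReal_mul_I, Complex.norm_of_nonneg hx, mul_one]

theorem polar_radius_angle (P : HPlane) : polar (radius P) (angle P) = P :=
  Complex.norm_mul_exp_arg_mul_I P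

theorem coe_angle_polar (hx : 0 < x) (θ : ℝ) : (angle (polar x θ) : Angle) = θ := by
  rw [angle, polar, Complex.exp_mul_I]
  simpa using Complex.arg_mul_cos_add_sin_mul_I_coe_angle hx (θ : Angle)

theorem sameAngle_polar (hx : 0 ≤ x) (P : HPlane) : SameAngle P (polar x (angle P)) := by
  rcases hx.eq_or_lt with rfl | hx
  · simp [SameAngle, polar]
  · refine Or.inr (Or.inr (Complex.arg_coe_angle_eq_iff.1 ?_))
    exact (coe_angle_polar hx (angle P)).symm

theorem rayComponent_congr {θ θ' : ℝ} (S : HPlane) (h : (θ : Angle) = θ') :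
    rayComponent S θ = rayComponent S θ' := by
  rw [rayComponent, rayComponent, ← Angle.cos_coe, ← Angle.cos_coe, Angle.coe_sub, Angle.coe_sub, h]

theorem cosh_hdist_polar (hx : 0 ≤ x) (θ : ℝ) (S : HPlane) :
    cosh (hdist (polar x θ) S) = cosh x * cosh (radius S) - sinh x * rayComponent S θ := by
  rw [cosh_hdist_eq_sub_rayComponent, radius_polar hx]
  rcases hx.eq_or_lt with rfl | hx
  · simp only [sinh_zero, zero_mul]
  · rw [rayComponent_congr S (coe_angle_polar hx θ)]

/-- The angle of `P` that is nearest to `θ₀`, chosen in `(θ₀ - π, θ₀ + π]`. Unlike `angle`, it is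
continuous at all points of the ray in the direction `θ₀` other than the pole. -/
noncomputable def angleNear (θ₀ : ℝ) (P : HPlane) : ℝ :=
  θ₀ + Complex.arg (P * Complex.exp (-θ₀ * Complex.I))

theorem polar_radius_angleNear (θ₀ : ℝ) (P : HPlane) : polar (radius P) (angleNear θ₀ P) = P := by
  have h := Complex.norm_mul_exp_arg_mul_I (P * Complex.exp (-θ₀ * Complex.I))
  have hnorm : ‖P * Complex.exp (-θ₀ * Complex.I)‖ = ‖P‖ := by
    simpa using congrArg (‖P‖ * ·) (Complex.norm_exp_ofReal_mul_I (-θ₀))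
  rw [hnorm] at h
  rw [polar, radius, angleNear, Complex.ofReal_add, add_mul, Complex.exp_add, mul_left_comm, h,
    mul_comm, mul_assoc, ← Complex.exp_add]
  simp

theorem tendsto_angleNear (hx : 0 < x) (θ₀ : ℝ) :
    Tendsto (angleNear θ₀) (𝓝 (polar x θ₀)) (𝓝 θ₀) := by
  have hrot : polar x θ₀ * Complex.exp (-θ₀ * Complex.I) = x := by
    rw [polar, mul_assoc, ← Complex.exp_add]
    simp
  have hcont : ContinuousAt (angleNear θ₀) (polar x θ₀) := by
    have harg := Complex.continuousAt_arg (x := x) (by simp [hx])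
    unfold angleNear
    refine continuousAt_const.add (ContinuousAt.comp (g := Complex.arg) ?_ (by fun_prop))
    rwa [hrot]
  have hval : angleNear θ₀ (polar x θ₀) = θ₀ := by
    rw [angleNear, hrot, Complex.arg_ofReal_of_nonneg hx.le, add_zero]
  simpa only [ContinuousAt, hval] using hcont

end Polar

section BeachEllipse

variable {S P : HPlane} {R x : ℝ}

theorem pos_of_radius_lt (hR : radius S < R) : 0 < R := (radius_nonneg S).trans_lt hR

theorem cosh_radius_lt_cosh (hR : radius S < R) : cosh (radius S) < cosh R :=
  cosh_strictMonoOn (radius_nonneg S) (pos_of_radius_lt hR).le hR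

theorem cosh_sub_cosh_lt_sinh_sub_rayComponent (hR : radius S < R) (θ : ℝ) :
    cosh R - cosh (radius S) < sinh R - rayComponent S θ := by
  have hexp : exp (-R) < exp (-radius S) := exp_lt_exp.2 (neg_lt_neg hR)
  rw [← cosh_sub_sinh, ← cosh_sub_sinh] at hexp
  linarith [(abs_le.1 (abs_rayComponent_le S θ)).2]

theorem rayComponent_lt_sinh (hR : radius S < R) (θ : ℝ) : rayComponent S θ < sinh R :=
  ((abs_le.1 (abs_rayComponent_le S θ)).2).trans_lt (sinh_lt_sinh.2 hR)

/-- The radius at which the ray in the direction `θ` meets the beach ellipse of `S` at sweep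
radius `R`. The formula is the polar equation of the ellipse, solved for the radius; it presupposes
`radius S < R`. -/
noncomputable def ellipseRadius (S : HPlane) (θ R : ℝ) : ℝ :=
  artanh ((cosh R - cosh (radius S)) / (sinh R - rayComponent S θ))

/-- The point in the direction `θ` of the beach ellipse of `S` at sweep radius `R`, which
presupposes `radius S < R`. -/
noncomputable def ellipsePoint (S : HPlane) (θ R : ℝ) : HPlane := polar (ellipseRadius S θ R) θ

theorem tanh_ellipseRadius_arg_mem_Ioo (hR : radius S < R) (θ : ℝ) :
    (cosh R - cosh (radius S)) / (sinh R - rayComponent S θ) ∈ Ioo 0 1 :=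
  have hden := sub_pos.2 (rayComponent_lt_sinh hR θ)
  ⟨div_pos (sub_pos.2 (cosh_radius_lt_cosh hR)) hden,
    (div_lt_one hden).2 (cosh_sub_cosh_lt_sinh_sub_rayComponent hR θ)⟩

theorem ellipseRadius_pos (hR : radius S < R) (θ : ℝ) : 0 < ellipseRadius S θ R :=
  artanh_pos (tanh_ellipseRadius_arg_mem_Ioo hR θ)

theorem sinh_ellipseRadius_mul (hR : radius S < R) (θ : ℝ) :
    sinh (ellipseRadius S θ R) * (sinh R - rayComponent S θ) =
      cosh (ellipseRadius S θ R) * (cosh R - cosh (radius S)) := by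
  have hmem := tanh_ellipseRadius_arg_mem_Ioo hR θ
  have htanh := tanh_artanh ⟨by linarith [hmem.1], hmem.2⟩
  rwa [← ellipseRadius, tanh_eq_sinh_div_cosh, div_eq_div_iff (cosh_pos _).ne'
    (sub_pos.2 (rayComponent_lt_sinh hR θ)).ne', mul_comm (_ - _)] at htanh

theorem cosh_ellipseRadius_mul_cosh_hdist_sub (hR : radius S < R) (hx : 0 ≤ x) (θ : ℝ) :
    cosh (ellipseRadius S θ R) * (cosh (hdist (polar x θ) S) - cosh (R - x)) =
      (sinh R - rayComponent S θ) * sinh (x - ellipseRadius S θ R) := by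
  rw [cosh_hdist_polar hx, cosh_sub R x, sinh_sub]
  linear_combination cosh x * sinh_ellipseRadius_mul hR θ

theorem cosh_hdist_polar_lt_cosh_iff (hR : radius S < R) (hx : 0 ≤ x) (θ : ℝ) :
    cosh (hdist (polar x θ) S) < cosh (R - x) ↔ x < ellipseRadius S θ R := by
  have h := cosh_ellipseRadius_mul_cosh_hdist_sub hR hx θ
  rw [← neg_inj, ← mul_neg, ← mul_neg, neg_sub, ← sinh_neg, neg_sub] at h
  rw [← sub_pos, ← mul_pos_iff_of_pos_left (cosh_pos (ellipseRadius S θ R)), h,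
    mul_pos_iff_of_pos_left (sub_pos.2 (rayComponent_lt_sinh hR θ)), sinh_pos_iff, sub_pos]

theorem cosh_lt_cosh_hdist_polar_iff (hR : radius S < R) (hx : 0 ≤ x) (θ : ℝ) :
    cosh (R - x) < cosh (hdist (polar x θ) S) ↔ ellipseRadius S θ R < x := by
  rw [← sub_pos, ← mul_pos_iff_of_pos_left (cosh_pos (ellipseRadius S θ R)),
    cosh_ellipseRadius_mul_cosh_hdist_sub hR hx,
    mul_pos_iff_of_pos_left (sub_pos.2 (rayComponent_lt_sinh hR θ)), sinh_pos_iff, sub_pos]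

theorem ellipseRadius_le (hR : radius S < R) (θ : ℝ) : ellipseRadius S θ R ≤ R := by
  by_contra! hlt
  have h := (cosh_hdist_polar_lt_cosh_iff hR (pos_of_radius_lt hR).le θ).2 hlt
  rw [sub_self, cosh_zero] at h
  exact h.not_ge (one_le_cosh _)

theorem hdist_polar_lt_iff (hR : radius S < R) (hx : 0 ≤ x) (θ : ℝ) :
    hdist (polar x θ) S < R - x ↔ x < ellipseRadius S θ R := by
  rcases le_or_gt x R with hxR | hxR
  · rw [← cosh_hdist_polar_lt_cosh_iff hR hx, cosh_lt_cosh, abs_of_nonneg (hdist_nonneg _ _),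
      abs_of_nonneg (sub_nonneg.2 hxR)]
  · exact iff_of_false (by linarith [hdist_nonneg (polar x θ) S])
      (by linarith [ellipseRadius_le hR θ])

theorem lt_hdist_polar_iff (hR : radius S < R) (hx : 0 ≤ x) (θ : ℝ) :
    R - x < hdist (polar x θ) S ↔ ellipseRadius S θ R < x := by
  rcases le_or_gt x R with hxR | hxR
  · rw [← cosh_lt_cosh_hdist_polar_iff hR hx, cosh_lt_cosh, abs_of_nonneg (hdist_nonneg _ _),
      abs_of_nonneg (sub_nonneg.2 hxR)]
  · exact iff_of_true (by linarith [hdist_nonneg (polar x θ) S])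
      (by linarith [ellipseRadius_le hR θ])

theorem polar_mem_beachEllipse_iff (hR : radius S < R) (hx : 0 ≤ x) (θ : ℝ) :
    polar x θ ∈ beachEllipse S R ↔ x = ellipseRadius S θ R := by
  rw [beachEllipse, mem_ofPred_eq, radius_polar hx, le_antisymm_iff, le_antisymm_iff,
    ← not_lt, ← not_lt, ← not_lt, ← not_lt, lt_hdist_polar_iff hR hx, hdist_polar_lt_iff hR hx]

theorem radius_ellipsePoint (hR : radius S < R) (θ : ℝ) :
    radius (ellipsePoint S θ R) = ellipseRadius S θ R :=
  radius_polar (ellipseRadius_pos hR θ).le θ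

theorem ellipsePoint_mem_beachEllipse (hR : radius S < R) (θ : ℝ) :
    ellipsePoint S θ R ∈ beachEllipse S R :=
  (polar_mem_beachEllipse_iff hR (ellipseRadius_pos hR θ).le θ).2 rfl

theorem ellipsePoint_angleNear (hR : radius S < R) (hP : P ∈ beachEllipse S R) (θ₀ : ℝ) :
    ellipsePoint S (angleNear θ₀ P) R = P := by
  rw [← polar_radius_angleNear θ₀ P, polar_mem_beachEllipse_iff hR (radius_nonneg P)] at hP
  rw [ellipsePoint, ← hP, polar_radius_angleNear]

theorem ellipsePoint_angle (hR : radius S < R) (hP : P ∈ beachEllipse S R) :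
    ellipsePoint S (angle P) R = P := by
  rw [← polar_radius_angle P, polar_mem_beachEllipse_iff hR (radius_nonneg P)] at hP
  rw [ellipsePoint, ← hP, polar_radius_angle]

theorem continuousAt_ellipsePoint (hR : radius S < R) (θ : ℝ) :
    ContinuousAt (fun p : ℝ × ℝ => ellipsePoint S p.1 p.2) (θ, R) := by
  have hmem := tanh_ellipseRadius_arg_mem_Ioo hR θ
  have hartanh : ContinuousAt artanh
      ((cosh R - cosh (radius S)) / (sinh R - rayComponent S θ)) := by
    unfold artanh
    have hden := (sub_pos.2 hmem.2).ne'
    refine ContinuousAt.log ?_ ?_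
    · exact (ContinuousAt.div (by fun_prop) (by fun_prop) hden).sqrt
    · exact (sqrt_pos.2 (div_pos (by linarith [hmem.1]) (sub_pos.2 hmem.2))).ne'
  have hradius : ContinuousAt (fun p : ℝ × ℝ => ellipseRadius S p.1 p.2) (θ, R) := by
    refine ContinuousAt.comp' (f := fun p : ℝ × ℝ =>
      (cosh p.2 - cosh (radius S)) / (sinh p.2 - rayComponent S p.1)) hartanh ?_
    unfold rayComponent
    exact ContinuousAt.div (by fun_prop) (by fun_prop)
      (sub_pos.2 (rayComponent_lt_sinh hR θ)).ne'
  exact continuous_polar.continuousAt.comp (hradius.prodMk continuousAt_fst)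

theorem continuous_ellipsePoint (hR : radius S < R) : Continuous fun θ => ellipsePoint S θ R :=
  continuous_iff_continuousAt.2 fun θ =>
    (continuousAt_ellipsePoint hR θ).comp' (f := fun θ => (θ, R)) (by fun_prop)

theorem radius_le_of_mem_beachEllipse (hP : P ∈ beachEllipse S R) : radius P ≤ R :=
  sub_nonneg.1 ((hdist_nonneg P S).trans_eq hP)

theorem ne_zero_of_mem_beachEllipse (hR : radius S < R) (hP : P ∈ beachEllipse S R) : P ≠ 0 := by
  rw [← radius_pos_iff, ← ellipsePoint_angle hR hP, radius_ellipsePoint hR]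
  exact ellipseRadius_pos hR _

theorem radius_lt_of_mem_beachEllipse (hR : radius S < R) (hP : P ∈ beachEllipse S R) :
    radius P < R := by
  refine (radius_le_of_mem_beachEllipse hP).lt_of_ne fun hPR => ?_
  have hPS : hdist P S = R - radius P := hP
  rw [hPR, sub_self, hdist_eq_zero_iff] at hPS
  exact hR.ne (hPS ▸ hPR)

end BeachEllipse

section ActivePart

variable {𝒮 : Finset HPlane} {S T P Q : HPlane} {R : ℝ}

theorem SameAngle.trans {U : HPlane} (h : SameAngle P Q) (hQ : Q ≠ 0) (h' : SameAngle Q U) :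
    SameAngle P U := by
  rcases h with h | h | h
  · exact Or.inl h
  · exact absurd h hQ
  · exact h'.elim (fun h' => absurd h' hQ) fun h' => h'.elim (fun h' => Or.inr (Or.inl h'))
      fun h' => Or.inr (Or.inr (h.trans h'))

theorem exists_farther_mem_beachEllipse_iff (hT : radius T < R) (hP : P ≠ 0) :
    (∃ P' ∈ beachEllipse T R, SameAngle P P' ∧ radius P < radius P') ↔
      hdist P T < R - radius P := by
  have hlt := hdist_polar_lt_iff hT (radius_nonneg P) (angle P)
  rw [polar_radius_angle] at hlt
  rw [hlt]
  refine ⟨?_, fun h => ⟨ellipsePoint T (angle P) R, ellipsePoint_mem_beachEllipse hT _,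
    sameAngle_polar (ellipseRadius_pos hT _).le P, (radius_ellipsePoint hT _).symm ▸ h⟩⟩
  rintro ⟨P', hP', hangle, hradius⟩
  have hangle : angle P = angle P' :=
    (hangle.resolve_left hP).resolve_left (radius_pos_iff.1 ((radius_nonneg P).trans_lt hradius))
  rwa [← ellipsePoint_angle hT hP', radius_ellipsePoint hT, ← hangle] at hradius

/-- The beach ellipse of a site on the sweep circle is the segment from the pole to the site. -/
theorem exists_farther_mem_beachEllipse_radius_iff (hPT : radius P < radius T) :
    (∃ P' ∈ beachEllipse T (radius T), SameAngle P P' ∧ radius P < radius P') ↔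
      hdist P T = radius T - radius P := by
  refine ⟨?_, fun h => ⟨T, ?_, ?_, hPT⟩⟩
  · rintro ⟨P', hP', hangle, hradius⟩
    have hP'T : SameAngle P' T := by
      rw [← hdist_eq_abs_radius_sub_iff, abs_sub_comm,
        abs_of_nonneg (sub_nonneg.2 (radius_le_of_mem_beachEllipse hP'))]
      exact hP'
    have hP'0 : P' ≠ 0 := radius_pos_iff.1 ((radius_nonneg P).trans_lt hradius)
    rw [hdist_eq_abs_radius_sub_iff.2 (hangle.trans hP'0 hP'T), abs_sub_comm,
      abs_of_pos (sub_pos.2 hPT)]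
  · rw [beachEllipse, mem_ofPred_eq, hdist_self, sub_self]
  · rw [← hdist_eq_abs_radius_sub_iff, h, abs_sub_comm, abs_of_pos (sub_pos.2 hPT)]

theorem mem_activePart_iff (hR : radius S < R) :
    P ∈ activePart 𝒮 S R ↔ P ∈ beachEllipse S R ∧ IsClosestSite 𝒮 P S ∧
      ∀ T ∈ 𝒮, radius T = R → hdist P S < hdist P T := by
  by_cases hP : P ∈ beachEllipse S R
  swap
  · exact iff_of_false (fun h => hP h.2.1) (fun h => hP h.1)
  have hPS : hdist P S = R - radius P := hP
  have hP0 := ne_zero_of_mem_beachEllipse hR hP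
  have hPR := radius_lt_of_mem_beachEllipse hR hP
  constructor
  · rintro ⟨⟨hS, -⟩, -, hno⟩
    have hlow (T : HPlane) (hRT : R ≤ radius T) : hdist P S ≤ hdist P T := by
      linarith [abs_radius_sub_le_hdist P T, neg_abs_le (radius P - radius T)]
    refine ⟨hP, ⟨hS, fun T hT => ?_⟩, fun T hT hTR => (hlow T hTR.ge).lt_of_ne fun h => ?_⟩
    · refine (lt_or_ge (radius T) R).elim (fun hTR => hPS ▸ not_lt.1 fun h => ?_) (hlow T)
      exact hno ⟨T, ⟨hT, hTR.le⟩, (exists_farther_mem_beachEllipse_iff hTR hP0).2 h⟩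
    · subst hTR
      exact hno ⟨T, ⟨hT, le_rfl⟩,
        (exists_farther_mem_beachEllipse_radius_iff hPR).2 (h.symm.trans hPS)⟩
  · rintro ⟨-, hclosest, hsweep⟩
    refine ⟨⟨hclosest.1, hR.le⟩, hP, ?_⟩
    rintro ⟨T, ⟨hT, hTR⟩, hfar⟩
    rcases hTR.lt_or_eq with hTR | rfl
    · have hlt := (exists_farther_mem_beachEllipse_iff hTR hP0).1 hfar
      exact (hPS ▸ hclosest.2 T hT).not_gt hlt
    · have heq := (exists_farther_mem_beachEllipse_radius_iff hPR).1 hfar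
      exact (hsweep T hT rfl).ne (hPS.trans heq.symm)

end ActivePart

section Voronoi

variable {𝒮 : Finset HPlane} {S T U V : HPlane} {r : ℝ}

theorem exists_isFarPoint (hV : V ∈ beachEllipse S r) (hS : IsClosestSite 𝒮 V S) :
    ∃ V', IsFarPoint 𝒮 V V' ∧ radius V' = r := by
  have hVS : hdist V S = r - radius V := hV
  have hVr := radius_le_of_mem_beachEllipse hV
  have hr : 0 ≤ r := (radius_nonneg V).trans hVr
  refine ⟨polar r (angle V), ⟨⟨S, hS, ?_⟩, ?_⟩, radius_polar hr _⟩
  · rw [hVS, hdist_eq_abs_radius_sub_iff.2 (sameAngle_polar hr V), radius_polar hr, abs_sub_comm,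
      abs_of_nonneg (sub_nonneg.2 hVr)]
  · rintro Q ⟨T, hT, hQ⟩
    rw [radius_polar hr]
    linarith [abs_radius_sub_le_hdist V Q, neg_abs_le (radius V - radius Q), hT.2 S hS.1]

theorem IsVoronoiVertex.mem_circleEvents (hV : IsVoronoiVertex 𝒮 V) (hVS : V ∈ beachEllipse S r)
    (hS : IsClosestSite 𝒮 V S) : r ∈ circleEvents 𝒮 :=
  let ⟨V', hV', hr⟩ := exists_isFarPoint hVS hS
  ⟨V, V', hV, hV', hr⟩

theorem hdist_lt_of_not_isVoronoiVertex (hV : ¬ IsVoronoiVertex 𝒮 V) (hS : IsClosestSite 𝒮 V S)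
    (hT : IsClosestSite 𝒮 V T) (hST : S ≠ T) (hU : U ∈ 𝒮) (hUS : U ≠ S) (hUT : U ≠ T) :
    hdist V S < hdist V U := by
  refine (hS.2 U hU).lt_of_ne fun heq => hV ?_
  exact ⟨S, T, U, hST, hUS.symm, hUT.symm, hS, hT, hU, fun W hW => heq ▸ hS.2 W hW⟩

theorem isClosestSite_of_mem_beachCurve (hr : r ∉ siteEvents 𝒮) (hV : V ∈ beachCurve 𝒮 r)
    (hS : S ∈ 𝒮) (hVS : V ∈ beachEllipse S r) : IsClosestSite 𝒮 V S := by
  obtain ⟨T, hT, hVT⟩ := mem_iUnion₂.1 hV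
  have hTr : radius T < r := hT.2.lt_of_ne fun h => hr ⟨T, hT.1, h⟩
  obtain ⟨hVT, hclosest, -⟩ := (mem_activePart_iff hTr).1 hVT
  refine ⟨hS, fun U hU => ?_⟩
  rw [show hdist V S = hdist V T from hVS.trans hVT.symm]
  exact hclosest.2 U hU

theorem mem_beachCurve_of_mem_inter {R : ℝ} (hS : S ∈ 𝒮) (hSR : radius S < R) (hTR : radius T < R)
    (hV : V ∈ beachEllipse S R ∩ beachEllipse T R)
    (hlt : ∀ U ∈ 𝒮, U ≠ S → U ≠ T → hdist V S < hdist V U) : V ∈ beachCurve 𝒮 R := by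
  refine mem_iUnion₂.2 ⟨S, ⟨hS, hSR.le⟩, (mem_activePart_iff hSR).2
    ⟨hV.1, ⟨hS, fun U hU => ?_⟩, fun U hU hUR => ?_⟩⟩
  · rcases eq_or_ne U S with rfl | hUS
    · rfl
    rcases eq_or_ne U T with rfl | hUT
    · exact (hV.1.trans hV.2.symm).le
    · exact (hlt U hU hUS hUT).le
  · exact hlt U hU (fun h => hSR.ne (h ▸ hUR)) (fun h => hTR.ne (h ▸ hUR))

theorem not_leavesBeachCurveAt (hsite : r ∉ siteEvents 𝒮) (hcircle : r ∉ circleEvents 𝒮)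
    (hS : S ∈ seenSites 𝒮 r) (hT : T ∈ seenSites 𝒮 r) (hST : S ≠ T) (I : ℝ → HPlane) :
    ¬ LeavesBeachCurveAt 𝒮 S T I r := by
  rintro ⟨ε, hε, hI, hmem, hr, hout⟩
  have hrε : r < r + ε := lt_add_of_pos_right r hε
  have hmem_r := hmem r (left_mem_Icc.2 hrε.le)
  have hSV := isClosestSite_of_mem_beachCurve hsite hr hS.1 hmem_r.1
  have hTV := isClosestSite_of_mem_beachCurve hsite hr hT.1 hmem_r.2
  have hV : ¬ IsVoronoiVertex 𝒮 (I r) := fun hV => hcircle (hV.mem_circleEvents hmem_r.1 hSV)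
  have hdist_tendsto (U : HPlane) :
      Tendsto (fun R => hdist (I R) U) (𝓝[>] r) (𝓝 (hdist (I r) U)) :=
    ((continuous_hdist_left U).tendsto _).comp
      ((hI r (left_mem_Icc.2 hrε.le)).mono_left (nhdsWithin_le_of_mem (Icc_mem_nhdsGT hrε)))
  have hlt : ∀ᶠ R in 𝓝[>] r, ∀ U ∈ 𝒮, U ≠ S → U ≠ T → hdist (I R) S < hdist (I R) U := by
    simp only [Finset.eventually_all, eventually_imp_distrib_left]
    intro U hU hUS hUT
    exact (hdist_tendsto S).eventually_lt (hdist_tendsto U)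
      (hdist_lt_of_not_isVoronoiVertex hV hSV hTV hST hU hUS hUT)
  obtain ⟨R, hlt, hR⟩ := (hlt.and (Ioc_mem_nhdsGT hrε)).exists
  exact hout R hR (mem_beachCurve_of_mem_inter hS.1 (hS.2.trans_lt hR.1) (hT.2.trans_lt hR.1)
    (hmem R (Ioc_subset_Icc_self hR)) hlt)

theorem ConsecutiveEvents.notMem_siteEvents_and_circleEvents {a b : EReal}
    (h : ConsecutiveEvents 𝒮 a b) (ha : a < (r : EReal)) (hb : (r : EReal) < b) :
    r ∉ siteEvents 𝒮 ∧ r ∉ circleEvents 𝒮 :=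
  ⟨fun hr => h.2.2.2 r (Or.inr ⟨r, Or.inl hr, rfl⟩) ⟨ha, hb⟩,
    fun hr => h.2.2.2 r (Or.inr ⟨r, Or.inr hr, rfl⟩) ⟨ha, hb⟩⟩

end Voronoi

section Excess

variable {S T : HPlane} {R θ : ℝ}

/-- The surplus of `cosh` of the distance to `T` over `cosh` of the distance to `S` at the point in
the direction `θ` of the beach ellipse of `S`, up to a positive factor; see
`cosh_hdist_sub_cosh_hdist_ellipsePoint`. -/
noncomputable def excess (S T : HPlane) (θ R : ℝ) : ℝ :=
  (cosh (radius T) - cosh (radius S)) * sinh R + (cosh R - cosh (radius T)) * rayComponent S θ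
    - (cosh R - cosh (radius S)) * rayComponent T θ

/-- The derivative of `excess S T θ R` with respect to `θ`. -/
noncomputable def excessDeriv (S T : HPlane) (θ R : ℝ) : ℝ :=
  (cosh R - cosh (radius S)) * (sinh (radius T) * sin (θ - angle T))
    - (cosh R - cosh (radius T)) * (sinh (radius S) * sin (θ - angle S))

theorem continuous_excess (S T : HPlane) : Continuous fun p : ℝ × ℝ => excess S T p.1 p.2 := by
  unfold excess rayComponent
  fun_prop

theorem continuous_excessDeriv (S T : HPlane) :
    Continuous fun p : ℝ × ℝ => excessDeriv S T p.1 p.2 := by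
  unfold excessDeriv
  fun_prop

theorem hasDerivAt_rayComponent (S : HPlane) (θ : ℝ) :
    HasDerivAt (rayComponent S) (-(sinh (radius S) * sin (θ - angle S))) θ := by
  refine (((hasDerivAt_id θ).sub_const (angle S)).cos.const_mul (sinh (radius S))).congr_deriv ?_
  rw [mul_one, mul_neg, id]

theorem hasDerivAt_excess (S T : HPlane) (θ R : ℝ) :
    HasDerivAt (fun θ => excess S T θ R) (excessDeriv S T θ R) θ := by
  refine ((((hasDerivAt_rayComponent S θ).const_mul _).const_add _).sub
    ((hasDerivAt_rayComponent T θ).const_mul _)).congr_deriv ?_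
  rw [excessDeriv]
  ring

theorem cosh_hdist_sub_cosh_hdist_ellipsePoint (T : HPlane) (hR : radius S < R) (θ : ℝ) :
    (cosh R - cosh (radius S)) *
        (cosh (hdist (ellipsePoint S θ R) T) - cosh (hdist (ellipsePoint S θ R) S)) =
      sinh (ellipseRadius S θ R) * excess S T θ R := by
  have hpos := (ellipseRadius_pos hR θ).le
  rw [ellipsePoint, cosh_hdist_polar hpos, cosh_hdist_polar hpos, excess]
  linear_combination (cosh (radius S) - cosh (radius T)) * sinh_ellipseRadius_mul hR θ

theorem hdist_le_iff_excess_nonneg (T : HPlane) (hR : radius S < R) (θ : ℝ) :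
    hdist (ellipsePoint S θ R) S ≤ hdist (ellipsePoint S θ R) T ↔ 0 ≤ excess S T θ R := by
  rw [← cosh_strictMonoOn.le_iff_le (hdist_nonneg _ S) (hdist_nonneg _ T), ← sub_nonneg,
    ← mul_nonneg_iff_of_pos_left (sub_pos.2 (cosh_radius_lt_cosh hR)),
    cosh_hdist_sub_cosh_hdist_ellipsePoint T hR,
    mul_nonneg_iff_of_pos_left (sinh_pos_iff.2 (ellipseRadius_pos hR θ))]

theorem hdist_lt_iff_excess_pos (T : HPlane) (hR : radius S < R) (θ : ℝ) :
    hdist (ellipsePoint S θ R) S < hdist (ellipsePoint S θ R) T ↔ 0 < excess S T θ R := by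
  rw [← cosh_strictMonoOn.lt_iff_lt (hdist_nonneg _ S) (hdist_nonneg _ T), ← sub_pos,
    ← mul_pos_iff_of_pos_left (sub_pos.2 (cosh_radius_lt_cosh hR)),
    cosh_hdist_sub_cosh_hdist_ellipsePoint T hR,
    mul_pos_iff_of_pos_left (sinh_pos_iff.2 (ellipseRadius_pos hR θ))]

theorem hdist_eq_iff_excess_eq_zero (T : HPlane) (hR : radius S < R) (θ : ℝ) :
    hdist (ellipsePoint S θ R) S = hdist (ellipsePoint S θ R) T ↔ excess S T θ R = 0 := by
  rw [eq_iff_le_not_lt, hdist_le_iff_excess_nonneg T hR, hdist_lt_iff_excess_pos T hR,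
    ← eq_iff_le_not_lt, eq_comm]

theorem sq_sub_excess_add_excessDeriv_sq (S T : HPlane) (θ R : ℝ) :
    ((cosh (radius T) - cosh (radius S)) * sinh R - excess S T θ R) ^ 2 + excessDeriv S T θ R ^ 2 =
      ((cosh (radius T) - cosh (radius S)) * sinh R) ^ 2
        + 2 * (cosh R - cosh (radius S)) * (cosh R - cosh (radius T)) *
          (cosh (hdist S T) - 1) := by
  have hangle : angle S - angle T = (θ - angle T) - (θ - angle S) := by ring
  rw [cosh_hdist, hangle, cos_sub, excess, excessDeriv, rayComponent, rayComponent]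
  linear_combination
    (cosh R - cosh (radius S)) ^ 2 * sinh (radius T) ^ 2 * sin_sq_add_cos_sq (θ - angle T)
    + (cosh R - cosh (radius T)) ^ 2 * sinh (radius S) ^ 2 * sin_sq_add_cos_sq (θ - angle S)
    - (cosh R - cosh (radius S)) ^ 2 * cosh_sq_sub_sinh_sq (radius T)
    - (cosh R - cosh (radius T)) ^ 2 * cosh_sq_sub_sinh_sq (radius S)
    + (cosh (radius T) - cosh (radius S)) ^ 2 * cosh_sq_sub_sinh_sq R

/-- Beach ellipses of distinct sites intersect transversally. -/
theorem excessDeriv_ne_zero (hS : radius S < R) (hT : radius T < R) (hST : S ≠ T)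
    (h : excess S T θ R = 0) : excessDeriv S T θ R ≠ 0 := by
  intro h'
  have hsq := sq_sub_excess_add_excessDeriv_sq S T θ R
  rw [h, h', sub_zero, zero_pow two_ne_zero, add_zero, left_eq_add] at hsq
  have hS := sub_pos.2 (cosh_radius_lt_cosh hS)
  have hT := sub_pos.2 (cosh_radius_lt_cosh hT)
  have hpos := sub_pos.2 (one_lt_cosh.2 (hdist_pos hST).ne')
  exact (by positivity : (0 : ℝ) ≠ _) hsq.symm

theorem excess_self (S : HPlane) (θ R : ℝ) : excess S S θ R = 0 := by
  unfold excess
  ring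

theorem excess_pos_of_lt_radius (hS : radius S < R) (hT : R < radius T) (θ : ℝ) :
    0 < excess S T θ R := by
  rw [← hdist_lt_iff_excess_pos T hS, ellipsePoint_mem_beachEllipse hS θ]
  linarith [abs_radius_sub_le_hdist (ellipsePoint S θ R) T,
    neg_abs_le (radius (ellipsePoint S θ R) - radius T)]

theorem excess_radius_eq (S T : HPlane) (θ : ℝ) :
    excess S T θ (radius T) = (cosh (radius T) - cosh (radius S)) * sinh (radius T) *
      (1 - cos (θ - angle T)) := by
  rw [excess, rayComponent.eq_def T]
  ring

theorem excess_nonneg_of_le_radius (hS : radius S < R) (hT : R ≤ radius T) (θ : ℝ) :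
    0 ≤ excess S T θ R := by
  rcases hT.lt_or_eq with hT | rfl
  · exact (excess_pos_of_lt_radius hS hT θ).le
  · rw [excess_radius_eq]
    exact mul_nonneg (mul_nonneg (sub_pos.2 (cosh_radius_lt_cosh hS)).le (sinh_radius_nonneg T))
      (sub_nonneg.2 (cos_le_one _))

theorem eventually_cos_sub_ne_one (θ a : ℝ) : ∀ᶠ x in 𝓝[≠] θ, cos (x - a) ≠ 1 := by
  by_cases hθ : cos (θ - a) = 1
  · have hmem : Ioo (θ - 2 * π) (θ + 2 * π) ∈ 𝓝 θ :=
      Ioo_mem_nhds (by linarith [pi_pos]) (by linarith [pi_pos])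
    filter_upwards [self_mem_nhdsWithin, nhdsWithin_le_nhds hmem] with x hx hmem h
    obtain ⟨k, hk⟩ := (cos_eq_one_iff _).1 hθ
    rw [← sub_add_sub_cancel x θ a, ← hk, cos_add_int_mul_two_pi, cos_eq_one_iff_of_lt_of_lt
      (by linarith [hmem.1]) (by linarith [hmem.2])] at h
    exact hx (sub_eq_zero.1 h)
  · have hcont : ContinuousAt (fun x => cos (x - a)) θ := by fun_prop
    exact nhdsWithin_le_nhds (hcont.eventually_ne hθ)

theorem eventually_excess_ne_zero (hS : radius S < R) (hST : S ≠ T) (θ : ℝ) :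
    ∀ᶠ x in 𝓝[≠] θ, excess S T x R ≠ 0 := by
  rcases lt_trichotomy (radius T) R with hT | rfl | hT
  · by_cases hθ : excess S T θ R = 0
    · exact (hasDerivAt_excess S T θ R).eventually_ne (excessDeriv_ne_zero hS hT hST hθ)
    · exact nhdsWithin_le_nhds ((hasDerivAt_excess S T θ R).continuousAt.eventually_ne hθ)
  · filter_upwards [eventually_cos_sub_ne_one θ (angle T)] with x hx
    rw [excess_radius_eq]
    exact mul_ne_zero (mul_pos (sub_pos.2 (cosh_radius_lt_cosh hS))
      (sinh_pos_iff.2 (pos_of_radius_lt hS))).ne' (sub_ne_zero.2 (Ne.symm hx))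
  · exact Eventually.of_forall fun x => (excess_pos_of_lt_radius hS hT x).ne'

theorem frequently_excess_pos (hS : radius S < R) (hST : S ≠ T) (hθ : 0 ≤ excess S T θ R) :
    ∃ᶠ x in 𝓝 θ, 0 < excess S T x R := by
  by_cases hθ0 : excess S T θ R = 0
  swap
  · exact ((hasDerivAt_excess S T θ R).continuousAt.eventually_const_lt
      (hθ.lt_of_ne' hθ0)).frequently
  rcases lt_or_ge (radius T) R with hT | hT
  · intro hle
    have hmax : IsLocalMax (fun x => excess S T x R) θ := by
      filter_upwards [hle] with x hx
      exact (not_lt.1 hx).trans hθ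
    exact excessDeriv_ne_zero hS hT hST hθ0 (hmax.hasDerivAt_eq_zero (hasDerivAt_excess S T θ R))
  · have hpos := (eventually_excess_ne_zero hS hST θ).mono fun x hx =>
      (excess_nonneg_of_le_radius hS hT x).lt_of_ne' hx
    exact hpos.frequently.filter_mono nhdsWithin_le_nhds

/-- Where the two ellipses meet, the excess is monotone by transversality. -/
theorem eventually_quasiconcaveOn_excess (hS : radius S < R) (hT : radius T < R) (hST : S ≠ T)
    (h : excess S T θ R = 0) :
    ∀ᶠ s in (𝓝 θ).smallSets, ∀ᶠ R' in 𝓝 R, Convex ℝ s →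
      QuasiconcaveOn ℝ s fun x => excess S T x R' := by
  have hderiv (x R' : ℝ) := hasDerivAt_excess S T x R'
  have hdiff (R' : ℝ) : Differentiable ℝ fun x => excess S T x R' :=
    fun x => (hderiv x R').differentiableAt
  have hlim := (continuous_excessDeriv S T).tendsto (θ, R)
  rw [nhds_prod_eq] at hlim
  rcases (excessDeriv_ne_zero hS hT hST h).lt_or_gt with hneg | hpos
  · obtain ⟨p, hp, q, hq, hpq⟩ := eventually_prod_iff.1 (hlim.eventually_lt_const hneg)
    filter_upwards [hp.smallSets] with s hs
    filter_upwards [hq] with R' hR' hconv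
    refine (antitoneOn_of_deriv_nonpos hconv (hdiff R').continuous.continuousOn
      (hdiff R').differentiableOn fun x hx => ?_).quasiconcaveOn hconv
    exact (hderiv x R').deriv.trans_le (hpq (hs x (interior_subset hx)) hR').le
  · obtain ⟨p, hp, q, hq, hpq⟩ := eventually_prod_iff.1 (hlim.eventually_const_lt hpos)
    filter_upwards [hp.smallSets] with s hs
    filter_upwards [hq] with R' hR' hconv
    refine (monotoneOn_of_deriv_nonneg hconv (hdiff R').continuous.continuousOn
      (hdiff R').differentiableOn fun x hx => ?_).quasiconcaveOn hconv
    exact (hpq (hs x (interior_subset hx)) hR').le.trans_eq (hderiv x R').deriv.symm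

end Excess

section ActiveDirections

variable {𝒮 : Finset HPlane} {S T : HPlane} {R r θ : ℝ}

/-- The directions in which the beach ellipse of `S` is active at the sweep radius `R`. -/
def activeDirections (𝒮 : Finset HPlane) (S : HPlane) (R : ℝ) : Set ℝ :=
  {θ | ellipsePoint S θ R ∈ activePart 𝒮 S R}

/-- The point of the beach ellipse of `S` in the direction `θ` is strictly closer to `S` than to
all other sites. -/
def IsInteriorDirection (𝒮 : Finset HPlane) (S : HPlane) (R θ : ℝ) : Prop :=
  ∀ T ∈ 𝒮, T ≠ S → 0 < excess S T θ R

theorem mem_activeDirections_iff (hS : S ∈ 𝒮) (hR : radius S < R) :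
    θ ∈ activeDirections 𝒮 S R ↔
      ∀ T ∈ 𝒮, T ≠ S → 0 ≤ excess S T θ R ∧ (radius T = R → 0 < excess S T θ R) := by
  rw [activeDirections, mem_ofPred_eq, mem_activePart_iff hR]
  simp only [← hdist_le_iff_excess_nonneg _ hR, ← hdist_lt_iff_excess_pos _ hR]
  refine ⟨fun h T hT _ => ⟨h.2.1.2 T hT, h.2.2 T hT⟩,
    fun h => ⟨ellipsePoint_mem_beachEllipse hR θ, ⟨hS, fun T hT => ?_⟩, fun T hT hTR => ?_⟩⟩
  · rcases eq_or_ne T S with rfl | hTS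
    · rfl
    · exact (h T hT hTS).1
  · exact (h T hT fun hTS => hR.ne (hTS ▸ hTR)).2 hTR

theorem IsInteriorDirection.mem_activeDirections (h : IsInteriorDirection 𝒮 S R θ) (hS : S ∈ 𝒮)
    (hR : radius S < R) : θ ∈ activeDirections 𝒮 S R :=
  (mem_activeDirections_iff hS hR).2 fun T hT hTS => ⟨(h T hT hTS).le, fun _ => h T hT hTS⟩

theorem IsInteriorDirection.eventually (h : IsInteriorDirection 𝒮 S r θ) :
    ∀ᶠ R in 𝓝 r, IsInteriorDirection 𝒮 S R θ := by
  simp only [IsInteriorDirection, Finset.eventually_all, eventually_imp_distrib_left]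
  intro T hT hTS
  have hcont : Continuous fun R => excess S T θ R :=
    (continuous_excess S T).comp (Continuous.prodMk_right θ)
  exact hcont.continuousAt.eventually_const_lt (h T hT hTS)

/-- Away from Voronoi vertices, `S` has at most one competitor, and the excess over a single
competitor is positive in directions arbitrarily close to `θ`. -/
theorem frequently_isInteriorDirection (hr : radius S < r)
    (hS : IsClosestSite 𝒮 (ellipsePoint S θ r) S)
    (hV : ¬ IsVoronoiVertex 𝒮 (ellipsePoint S θ r)) :
    ∃ᶠ x in 𝓝 θ, IsInteriorDirection 𝒮 S r x := by
  obtain ⟨T, hT, hlt⟩ : ∃ T, (T ≠ S → 0 ≤ excess S T θ r) ∧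
      ∀ U ∈ 𝒮, U ≠ S → U ≠ T → 0 < excess S U θ r := by
    simp only [← hdist_le_iff_excess_nonneg _ hr, ← hdist_lt_iff_excess_pos _ hr]
    by_cases hT : ∃ T, T ≠ S ∧ IsClosestSite 𝒮 (ellipsePoint S θ r) T
    · obtain ⟨T, hTS, hT⟩ := hT
      exact ⟨T, fun _ => hS.2 T hT.1,
        fun U hU => hdist_lt_of_not_isVoronoiVertex hV hS hT hTS.symm hU⟩
    · refine ⟨S, fun h => absurd rfl h, fun U hU hUS _ => (hS.2 U hU).lt_of_ne fun heq => ?_⟩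
      exact hT ⟨U, hUS, hU, fun W hW => heq ▸ hS.2 W hW⟩
  have hfreq : ∃ᶠ x in 𝓝 θ, T ≠ S → 0 < excess S T x r := by
    rcases eq_or_ne T S with rfl | hTS
    · exact Frequently.of_forall fun _ h => absurd rfl h
    · exact (frequently_excess_pos hr hTS.symm (hT hTS)).mono fun _ h _ => h
  have hothers : ∀ᶠ x in 𝓝 θ, ∀ U ∈ 𝒮, U ≠ S → U ≠ T → 0 < excess S U x r := by
    simp only [Finset.eventually_all, eventually_imp_distrib_left]
    exact fun U hU hUS hUT =>
      (hasDerivAt_excess S U θ r).continuousAt.eventually_const_lt (hlt U hU hUS hUT)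
  refine (hfreq.and_eventually hothers).mono fun x hx U hU hUS => ?_
  rcases eq_or_ne U T with rfl | hUT
  · exact hx.1 hUS
  · exact hx.2 U hU hUS hUT

theorem eventually_convex_sep_excess (hS : radius S < r) (hST : S ≠ T)
    (hθ : 0 ≤ excess S T θ r) :
    ∀ᶠ s in (𝓝 θ).smallSets, ∀ᶠ R in 𝓝 r,
      (R < r ∨ (radius T = r → 0 < excess S T θ r)) → Convex ℝ s →
        Convex ℝ {x ∈ s | 0 ≤ excess S T x R ∧ (radius T = R → 0 < excess S T x R)} := by
  rcases hθ.lt_or_eq with hθ | hθ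
  · have hlim := (continuous_excess S T).tendsto (θ, r)
    rw [nhds_prod_eq] at hlim
    obtain ⟨p, hp, q, hq, hpq⟩ := eventually_prod_iff.1 (hlim.eventually_const_lt hθ)
    filter_upwards [hp.smallSets] with s hs
    filter_upwards [hq] with R hR _ hconv
    rwa [sep_eq_self_iff_mem_true.2 fun x hx => ⟨(hpq (hs x hx) hR).le, fun _ => hpq (hs x hx) hR⟩]
  have hTr : radius T ≤ r := not_lt.1 fun h => (excess_pos_of_lt_radius hS h θ).ne hθ
  rcases hTr.lt_or_eq with hTr | hTr
  · filter_upwards [eventually_quasiconcaveOn_excess hS hTr hST hθ.symm] with s hs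
    filter_upwards [hs, lt_mem_nhds hTr] with R hR hTR _ hconv
    simpa only [hTR.ne, IsEmpty.forall_iff, and_true] using hR hconv 0
  · refine Eventually.of_forall fun s => ?_
    filter_upwards [lt_mem_nhds hS] with R hSR hR hconv
    have hRT : R < radius T := hTr ▸ hR.resolve_right fun h => (h hTr).ne hθ
    rwa [sep_eq_self_iff_mem_true.2 fun x _ =>
      ⟨(excess_pos_of_lt_radius hSR hRT x).le, fun h => absurd h hRT.ne'⟩]

theorem eventually_convex_inter_activeDirections (hS : S ∈ 𝒮) (hr : radius S < r)
    (hθ : ∀ T ∈ 𝒮, 0 ≤ excess S T θ r) :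
    ∀ᶠ s in (𝓝 θ).smallSets, ∀ᶠ R in 𝓝 r, (R < r ∨ θ ∈ activeDirections 𝒮 S r) → Convex ℝ s →
      Convex ℝ (s ∩ activeDirections 𝒮 S R) := by
  have hsites : ∀ᶠ s in (𝓝 θ).smallSets, ∀ᶠ R in 𝓝 r, ∀ T ∈ 𝒮, T ≠ S →
      (R < r ∨ (radius T = r → 0 < excess S T θ r)) → Convex ℝ s →
        Convex ℝ {x ∈ s | 0 ≤ excess S T x R ∧ (radius T = R → 0 < excess S T x R)} := by
    simp only [Finset.eventually_all, eventually_imp_distrib_left]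
    exact fun T hT hTS => eventually_convex_sep_excess hr hTS.symm (hθ T hT)
  filter_upwards [hsites] with s hs
  filter_upwards [hs, lt_mem_nhds hr] with R hR hSR hactive hconv
  have hinter : s ∩ activeDirections 𝒮 S R = s ∩ ⋂ T ∈ 𝒮, ⋂ _ : T ≠ S,
      {x ∈ s | 0 ≤ excess S T x R ∧ (radius T = R → 0 < excess S T x R)} := by
    ext x
    simp only [mem_inter_iff, mem_iInter, mem_ofPred_eq, mem_activeDirections_iff hS hSR]
    exact and_congr_right fun hx => forall₃_congr fun _ _ _ => (and_iff_right hx).symm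
  rw [hinter]
  refine hconv.inter (convex_iInter₂ fun T hT => convex_iInter fun hTS => hR T hT hTS ?_ hconv)
  exact hactive.imp_right fun h => ((mem_activeDirections_iff hS hr).1 h T hT hTS).2

end ActiveDirections

section ActiveSegment

variable {𝒮 : Finset HPlane} {S : HPlane} {R r θ : ℝ} {C : Set HPlane}

theorem IsActiveSegment.subset (h : IsActiveSegment 𝒮 S R C) : C ⊆ activePart 𝒮 S R := by
  obtain ⟨P, -, rfl⟩ := h
  exact connectedComponentIn_subset _ _

theorem IsActiveSegment.isPreconnected (h : IsActiveSegment 𝒮 S R C) : IsPreconnected C := by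
  obtain ⟨P, -, rfl⟩ := h
  exact isPreconnected_connectedComponentIn

theorem IsActiveSegment.nonempty (h : IsActiveSegment 𝒮 S R C) : C.Nonempty := by
  obtain ⟨P, hP, rfl⟩ := h
  exact ⟨P, mem_connectedComponentIn hP⟩

theorem IsActiveSegment.subset_of_isPreconnected (h : IsActiveSegment 𝒮 S R C) {X : Set HPlane}
    (hX : IsPreconnected X) (hXA : X ⊆ activePart 𝒮 S R) (hCX : (C ∩ X).Nonempty) : X ⊆ C := by
  obtain ⟨Q, -, rfl⟩ := h
  obtain ⟨P, hPC, hPX⟩ := hCX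
  rw [connectedComponentIn_eq hPC]
  exact hX.subset_connectedComponentIn hPX hXA

/-- Near `ellipsePoint S θ r` the ellipse of `S` has at most one active segment, since its active
directions form an interval there. -/
theorem exists_nhds_eventually_ellipsePoint_mem (hS : S ∈ 𝒮) (hr : radius S < r)
    (hθ : ∀ T ∈ 𝒮, 0 ≤ excess S T θ r) :
    ∃ s ∈ 𝓝 θ, ∀ᶠ p : HPlane × ℝ in 𝓝 (ellipsePoint S θ r) ×ˢ 𝓝 r,
      (p.2 < r ∨ θ ∈ activeDirections 𝒮 S r) → ∀ C, IsActiveSegment 𝒮 S p.2 C → p.1 ∈ C →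
        ∀ x ∈ s ∩ activeDirections 𝒮 S p.2, ellipsePoint S x p.2 ∈ C := by
  obtain ⟨t, ht, hconv⟩ :=
    eventually_smallSets.1 (eventually_convex_inter_activeDirections hS hr hθ)
  obtain ⟨δ, hδ, hball⟩ := Metric.mem_nhds_iff.1 ht
  have hnear : ∀ᶠ P in 𝓝 (ellipsePoint S θ r), angleNear θ P ∈ Metric.ball θ δ :=
    (tendsto_angleNear (ellipseRadius_pos hr θ) θ).eventually (Metric.ball_mem_nhds θ hδ)
  refine ⟨Metric.ball θ δ, Metric.ball_mem_nhds θ hδ, ?_⟩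
  filter_upwards [hnear.prod_inl _, (hconv _ hball).prod_inr _, (lt_mem_nhds hr).prod_inr _]
    with p hp hconv hSp hactive C hC hpC x hx
  have hpE := ellipsePoint_angleNear hSp (hC.subset hpC).2.1 θ
  have hconn := (hconv hactive (convex_ball θ δ)).isPreconnected.image
    (fun y => ellipsePoint S y p.2) (continuous_ellipsePoint hSp).continuousOn
  refine hC.subset_of_isPreconnected hconn (image_subset_iff.2 fun y hy => hy.2)
    ⟨p.1, hpC, angleNear θ p.1, ⟨hp, ?_⟩, hpE⟩ (mem_image_of_mem _ hx)
  rw [activeDirections, mem_ofPred_eq, hpE]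
  exact hC.subset hpC

theorem IsInteriorDirection.exists_ball_eventually_mem (hθ : IsInteriorDirection 𝒮 S r θ)
    (hS : S ∈ 𝒮) (hr : radius S < r) :
    ∃ δ > 0, ∀ᶠ R in 𝓝 r, ∀ C, IsActiveSegment 𝒮 S R C →
      (C ∩ Metric.ball (ellipsePoint S θ r) δ).Nonempty → ellipsePoint S θ R ∈ C := by
  have hnonneg : ∀ T ∈ 𝒮, 0 ≤ excess S T θ r := fun T hT => by
    rcases eq_or_ne T S with rfl | hTS
    · exact (excess_self _ _ _).ge
    · exact (hθ T hT hTS).le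
  obtain ⟨s, hs, hunique⟩ := exists_nhds_eventually_ellipsePoint_mem hS hr hnonneg
  obtain ⟨p, hp, q, hq, hpq⟩ := eventually_prod_iff.1 hunique
  obtain ⟨δ, hδ, hball⟩ := Metric.mem_nhds_iff.1 hp
  refine ⟨δ, hδ, ?_⟩
  filter_upwards [hq, lt_mem_nhds hr, hθ.eventually] with R hR hSR hθR C hC ⟨P, hPC, hP⟩
  exact hpq (hball hP) hR (Or.inr (hθ.mem_activeDirections hS hr)) C hC hPC θ
    ⟨mem_of_mem_nhds hs, hθR.mem_activeDirections hS hSR⟩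

end ActiveSegment

section IncidentVertices

variable {𝒮 : Finset HPlane} {S V : HPlane} {r : ℝ}

/-- The Voronoi vertices incident to `S` that lie on the beach ellipse of `S` at the sweep radius
`r`. By `exists_isFarPoint` these are the vertices whose circle event takes place at `r`. -/
def incidentVertices (𝒮 : Finset HPlane) (S : HPlane) (r : ℝ) : Set HPlane :=
  {V | V ∈ beachEllipse S r ∧ IsClosestSite 𝒮 V S ∧ IsVoronoiVertex 𝒮 V}

theorem IsVoronoiVertex.exists_hdist_eq (hV : IsVoronoiVertex 𝒮 V) (hS : IsClosestSite 𝒮 V S) :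
    ∃ T ∈ 𝒮, T ≠ S ∧ hdist V S = hdist V T := by
  obtain ⟨S₁, S₂, -, h₁₂, -, -, h₁, h₂, -⟩ := hV
  have heq {T : HPlane} (hT : IsClosestSite 𝒮 V T) : hdist V S = hdist V T :=
    (hS.2 T hT.1).antisymm (hT.2 S hS.1)
  rcases ne_or_eq S₁ S with h | rfl
  · exact ⟨S₁, h₁.1, h, heq h₁⟩
  · exact ⟨S₂, h₂.1, h₁₂.symm, heq h₂⟩

theorem eventually_notMem_incidentVertices (hr : radius S < r) (hV : V ∈ beachEllipse S r) :
    ∀ᶠ P in 𝓝[≠] V, P ∉ incidentVertices 𝒮 S r := by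
  have hne : ∀ᶠ x in 𝓝[≠] (angle V), ∀ T ∈ 𝒮, T ≠ S → excess S T x r ≠ 0 := by
    simp only [Finset.eventually_all, eventually_imp_distrib_left]
    exact fun T _ hTS => eventually_excess_ne_zero hr hTS.symm _
  have hlim := tendsto_angleNear (radius_pos_iff.2 (ne_zero_of_mem_beachEllipse hr hV)) (angle V)
  rw [polar_radius_angle] at hlim
  rw [eventually_nhdsWithin_iff] at hne ⊢
  filter_upwards [hlim.eventually hne] with P hP hPV ⟨hPE, hPS, hPV'⟩
  obtain ⟨T, hT, hTS, heq⟩ := hPV'.exists_hdist_eq hPS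
  have hpt := ellipsePoint_angleNear hr hPE (angle V)
  refine hP (fun hangle => hPV ?_) T hT hTS ?_
  · rw [← hpt, mem_singleton_iff.1 hangle, ellipsePoint_angle hr hV, mem_singleton_iff]
  · rwa [← hdist_eq_iff_excess_eq_zero T hr, hpt]

theorem isDiscrete_incidentVertices (hr : radius S < r) :
    IsDiscrete (incidentVertices 𝒮 S r) := by
  rw [isDiscrete_iff_nhdsNE]
  exact fun V hV => inf_principal_eq_bot.2 (eventually_notMem_incidentVertices hr hV.1)

theorem isClosed_setOf_mem_beachEllipse_and_isClosestSite (𝒮 : Finset HPlane) (S : HPlane) :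
    IsClosed {p : HPlane × ℝ | p.1 ∈ beachEllipse S p.2 ∧ IsClosestSite 𝒮 p.1 S} := by
  have hhdist (T : HPlane) : Continuous fun p : HPlane × ℝ => hdist p.1 T :=
    (continuous_hdist_left T).comp continuous_fst
  refine (isClosed_eq (hhdist S) (continuous_snd.sub (continuous_radius.comp continuous_fst))).and
    (isClosed_const.and ?_)
  simp only [ofPred_forall]
  exact isClosed_biInter fun T _ => isClosed_le (hhdist S) (hhdist T)

end IncidentVertices

section MovingSegment

variable {𝒮 : Finset HPlane} {S V : HPlane} {J : Set ℝ} {C : ℝ → Set HPlane} {r θ : ℝ}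

theorem IsMovingSegment.inter_nonempty_of_isPreconnected (hC : IsMovingSegment 𝒮 S J C)
    {J' : Set ℝ} (hJ' : IsPreconnected J') (hJ : J' ⊆ J) {K : Set HPlane} {δ : ℝ} (hδ : 0 < δ)
    (hK : ∀ R ∈ J', (C R ∩ Metric.thickening δ K).Nonempty → (C R ∩ K).Nonempty) {R₁ R₂ : ℝ}
    (h₁ : R₁ ∈ J') (h₂ : R₂ ∈ J') (hne : (C R₁ ∩ K).Nonempty) : (C R₂ ∩ K).Nonempty := by
  obtain ⟨η, hη, hdist_lt⟩ := exists_hdist_lt_imp_dist_lt hδ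
  refine hJ'.induction₂' (fun x y => (C x ∩ K).Nonempty → (C y ∩ K).Nonempty) (fun R₀ hR₀ => ?_)
    (fun _ _ _ _ _ _ hxy hyz hx => hyz (hxy hx)) h₁ h₂ hne
  filter_upwards [nhdsWithin_mono _ hJ (hC.2 R₀ (hJ hR₀) η hη), self_mem_nhdsWithin]
    with R hR hRJ
  constructor
  · rintro ⟨Q, hQ, hQK⟩
    obtain ⟨P, hP, hPQ⟩ := hR.2 Q hQ
    exact hK R hRJ ⟨P, hP, Metric.mem_thickening_iff.2 ⟨Q, hQK, hdist_lt P Q hPQ⟩⟩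
  · rintro ⟨P, hP, hPK⟩
    obtain ⟨Q, hQ, hPQ⟩ := hR.1 P hP
    exact hK R₀ hR₀ ⟨Q, hQ, Metric.mem_thickening_iff.2
      ⟨P, hPK, (dist_comm Q P).trans_lt (hdist_lt P Q hPQ)⟩⟩

theorem IsMovingSegment.eventually_inter_nonempty (hC : IsMovingSegment 𝒮 S J C)
    (hJ : J.OrdConnected) {K : Set HPlane} {δ : ℝ} (hδ : 0 < δ)
    (hK : ∀ᶠ R in 𝓝[J] r, (C R ∩ Metric.thickening δ K).Nonempty → (C R ∩ K).Nonempty)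
    (hfreq : ∃ᶠ R in 𝓝[J] r, (C R ∩ K).Nonempty) : ∀ᶠ R in 𝓝[J] r, (C R ∩ K).Nonempty := by
  obtain ⟨ε, hε, hball⟩ := Metric.mem_nhdsWithin_iff.1 hK
  have hconn : IsPreconnected (Metric.ball r ε ∩ J) := by
    rw [Real.ball_eq_Ioo]
    exact (ordConnected_Ioo.inter hJ).isPreconnected
  have hmem : Metric.ball r ε ∩ J ∈ 𝓝[J] r :=
    inter_mem (mem_nhdsWithin_of_mem_nhds (Metric.ball_mem_nhds r hε)) self_mem_nhdsWithin
  obtain ⟨R₁, hne, hR₁⟩ := (hfreq.and_eventually hmem).exists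
  filter_upwards [hmem] with R hR
  exact hC.inter_nonempty_of_isPreconnected hconn inter_subset_right hδ hball hR₁ hR hne

theorem IsMovingSegment.eventually_ellipsePoint_mem (hC : IsMovingSegment 𝒮 S J C)
    (hJ : J.OrdConnected) (hS : S ∈ 𝒮) (hr : radius S < r) (hθ : IsInteriorDirection 𝒮 S r θ)
    (hfreq : ∃ᶠ R in 𝓝[J] r, ellipsePoint S θ R ∈ C R) :
    ∀ᶠ R in 𝓝[J] r, ellipsePoint S θ R ∈ C R := by
  obtain ⟨δ, hδ, hball⟩ := hθ.exists_ball_eventually_mem hS hr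
  have hmem : ∀ᶠ R in 𝓝[J] r, (C R ∩ Metric.ball (ellipsePoint S θ r) δ).Nonempty →
      ellipsePoint S θ R ∈ C R := by
    filter_upwards [eventually_nhdsWithin_of_eventually_nhds hball, self_mem_nhdsWithin]
      with R hR hRJ using hR (C R) (hC.1 R hRJ)
  have hnear : ∀ᶠ R in 𝓝[J] r,
      ellipsePoint S θ R ∈ Metric.ball (ellipsePoint S θ r) (δ / 2) := by
    have hcont : ContinuousAt (fun R => ellipsePoint S θ R) r :=
      (continuousAt_ellipsePoint hr θ).comp (f := fun R => (θ, R)) (by fun_prop)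
    exact eventually_nhdsWithin_of_eventually_nhds
      (hcont.eventually_mem (Metric.ball_mem_nhds _ (half_pos hδ)))
  have hinter : ∀ᶠ R in 𝓝[J] r,
      (C R ∩ Metric.ball (ellipsePoint S θ r) (δ / 2)).Nonempty := by
    refine hC.eventually_inter_nonempty hJ (half_pos hδ) ?_
      ((hfreq.and_eventually hnear).mono fun R hR => ⟨_, hR⟩)
    rw [thickening_ball (half_pos hδ) (half_pos hδ), add_halves]
    filter_upwards [hmem, hnear] with R hR hR' hne using ⟨_, hR hne, hR'⟩
  filter_upwards [hinter, hmem] with R hne hR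
  exact hR (hne.mono (inter_subset_inter_right _ (Metric.ball_subset_ball (half_le_self hδ.le))))

theorem remainsActiveBeyond_of_eventually_mem [(𝓝[J] r).NeBot] (hJr : ∀ R ∈ J, R ≤ r)
    (hS : S ∈ 𝒮) (hr : radius S < r) (hθ : IsInteriorDirection 𝒮 S r θ)
    (hmem : ∀ᶠ R in 𝓝[J] r, ellipsePoint S θ R ∈ C R) : RemainsActiveBeyond 𝒮 S J C r := by
  obtain ⟨ε, hε, hball⟩ := Metric.eventually_nhds_iff_ball.1
    ((eventually_nhdsWithin_iff.1 hmem).and ((lt_mem_nhds hr).and hθ.eventually))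
  simp only [Real.ball_eq_Ioo] at hball
  have hIoo : Ioo (r - ε) (r + ε) ∈ 𝓝 r := Ioo_mem_nhds (by linarith) (by linarith)
  obtain ⟨a, haJ, ha⟩ := (eventually_mem_nhdsWithin.and
    (eventually_nhdsWithin_of_eventually_nhds hIoo) : ∀ᶠ R in 𝓝[J] r, _).exists
  refine ⟨a, haJ, ε / 2, half_pos hε, fun R => ellipsePoint S θ R, fun R hR => ?_,
    fun R hR haR => ?_, fun R hR => ?_⟩
  · have hSR : radius S < R := (hball a ha).2.1.trans_le hR.1
    exact ((continuousAt_ellipsePoint hSR θ).comp (f := fun R => (θ, R))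
      (by fun_prop)).continuousWithinAt
  · exact (hball R ⟨ha.1.trans_le haR, by linarith [hJr R hR]⟩).1 hR
  · obtain ⟨-, hSR, hθR⟩ := hball R ⟨by linarith [hR.1], by linarith [hR.2]⟩
    exact hθR.mem_activeDirections hS hSR

theorem IsMovingSegment.mem_beachEllipse_and_isClosestSite (hC : IsMovingSegment 𝒮 S J C)
    (hr : radius S < r) (hV : ∃ᶠ p : HPlane × ℝ in 𝓝 V ×ˢ 𝓝[J] r, p.1 ∈ C p.2) :
    V ∈ beachEllipse S r ∧ IsClosestSite 𝒮 V S := by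
  have hSJ : ∀ᶠ R in 𝓝[J] r, R ∈ J ∧ radius S < R :=
    eventually_mem_nhdsWithin.and (eventually_nhdsWithin_of_eventually_nhds (lt_mem_nhds hr))
  have hle : 𝓝 V ×ˢ 𝓝[J] r ≤ 𝓝 (V, r) :=
    (Filter.prod_mono le_rfl nhdsWithin_le_nhds).trans_eq nhds_prod_eq.symm
  refine isClosed_iff_frequently.1 (isClosed_setOf_mem_beachEllipse_and_isClosestSite 𝒮 S) (V, r)
    (((hV.and_eventually (hSJ.prod_inr _)).mono ?_).filter_mono hle)
  rintro p ⟨hp, hpJ, hSp⟩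
  obtain ⟨hpE, hpS, -⟩ := (mem_activePart_iff hSp).1 ((hC.1 p.2 hpJ).subset hp)
  exact ⟨hpE, hpS⟩

/-- Off the Voronoi vertices, the active directions near `V` form an interval that contains
interior directions; the ellipse point in such a direction would survive `r`. -/
theorem IsMovingSegment.mem_incidentVertices (hC : IsMovingSegment 𝒮 S J C) (hJ : J.OrdConnected)
    (hJr : ∀ R ∈ J, R ≤ r) (hS : S ∈ 𝒮) (hr : radius S < r)
    (hinactive : ¬ RemainsActiveBeyond 𝒮 S J C r)
    (hV : ∃ᶠ p : HPlane × ℝ in 𝓝 V ×ˢ 𝓝[J] r, p.1 ∈ C p.2) (hVr : r ∈ J → V ∈ C r) :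
    V ∈ incidentVertices 𝒮 S r := by
  obtain ⟨hVE, hVS⟩ := hC.mem_beachEllipse_and_isClosestSite hr hV
  refine ⟨hVE, hVS, by_contra fun hvertex => hinactive ?_⟩
  have hpt := ellipsePoint_angle hr hVE
  have hnonneg : ∀ T ∈ 𝒮, 0 ≤ excess S T (angle V) r := fun T hT => by
    rw [← hdist_le_iff_excess_nonneg T hr, hpt]
    exact hVS.2 T hT
  have hbefore : ∀ R ∈ J, R < r ∨ angle V ∈ activeDirections 𝒮 S r := fun R hR => by
    refine (hJr R hR).lt_or_eq.imp_right fun hRr => ?_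
    rw [activeDirections, mem_ofPred_eq, hpt]
    exact (hC.1 r (hRr ▸ hR)).subset (hVr (hRr ▸ hR))
  obtain ⟨s, hs, hunique⟩ := exists_nhds_eventually_ellipsePoint_mem hS hr hnonneg
  rw [hpt] at hunique
  obtain ⟨θ, hθ, hθs⟩ := ((frequently_isInteriorDirection hr (hpt.symm ▸ hVS)
    (hpt.symm ▸ hvertex)).and_eventually hs).exists
  have hθC : ∃ᶠ R in 𝓝[J] r, ellipsePoint S θ R ∈ C R := by
    have hθJ : ∀ᶠ R in 𝓝[J] r, R ∈ J ∧ radius S < R ∧ IsInteriorDirection 𝒮 S R θ :=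
      eventually_mem_nhdsWithin.and
        (eventually_nhdsWithin_of_eventually_nhds ((lt_mem_nhds hr).and hθ.eventually))
    have hunique' := hunique.filter_mono
      (Filter.prod_mono le_rfl (nhdsWithin_le_nhds : 𝓝[J] r ≤ 𝓝 r))
    refine (tendsto_snd (f := 𝓝 V)).frequently
      ((hV.and_eventually (hunique'.and (hθJ.prod_inr _))).mono ?_)
    rintro p ⟨hp, hunique, hpJ, hSp, hθp⟩
    exact hunique (hbefore p.2 hpJ) (C p.2) (hC.1 p.2 hpJ) hp θ
      ⟨hθs, hθp.mem_activeDirections hS hSp⟩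
  have : (𝓝[J] r).NeBot := ⟨fun h => hθC (h ▸ eventually_bot)⟩
  exact remainsActiveBeyond_of_eventually_mem hJr hS hr hθ
    (hC.eventually_ellipsePoint_mem hJ hS hr hθ hθC)

end MovingSegment

section Shrinking

variable {𝒮 : Finset HPlane} {S V : HPlane} {J : Set ℝ} {C : ℝ → Set HPlane} {r : ℝ}

/-- The sets `C R` shrink to the point `V` along the filter `l` of sweep radii. -/
def ShrinksTo (C : ℝ → Set HPlane) (l : Filter ℝ) (V : HPlane) : Prop :=
  ∀ δ > 0, ∀ᶠ R in l, ∀ P ∈ C R, hdist P V < δ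

theorem shrinksTo_of_eventually_subset_ball {l : Filter ℝ}
    (h : ∀ δ > 0, ∀ᶠ R in l, C R ⊆ Metric.ball V δ) : ShrinksTo C l V := by
  intro δ hδ
  have hnear : ∀ᶠ P in 𝓝 V, hdist P V < δ :=
    (continuous_hdist_left V).continuousAt.eventually_lt_const ((hdist_self V).trans_lt hδ)
  obtain ⟨η, hη, hball⟩ := Metric.eventually_nhds_iff_ball.1 hnear
  filter_upwards [h η hη] with R hR P hP using hball P (hR hP)

theorem eventually_disjoint_of_isCompact {X Y : Type*} [TopologicalSpace X] {l : Filter Y}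
    {C : Y → Set X} {K : Set X} (hK : IsCompact K)
    (h : ∀ P ∈ K, ∀ᶠ p in 𝓝 P ×ˢ l, p.1 ∉ C p.2) : ∀ᶠ R in l, Disjoint K (C R) := by
  obtain ⟨u, hu, v, hv, huv⟩ := mem_prod_iff.1 (hK.mem_nhdsSet_prod_of_forall h)
  filter_upwards [hv] with R hR
  exact disjoint_left.2 fun P hP => huv (mk_mem_prod (subset_of_mem_nhdsSet hu hP) hR)

theorem IsMovingSegment.exists_frequently_mem [(𝓝[J] r).NeBot] (hC : IsMovingSegment 𝒮 S J C)
    (hJr : ∀ R ∈ J, R ≤ r) : ∃ V, ∃ᶠ p : HPlane × ℝ in 𝓝 V ×ˢ 𝓝[J] r, p.1 ∈ C p.2 := by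
  by_contra! hV
  obtain ⟨R, hdisj, hR⟩ := ((eventually_disjoint_of_isCompact (isCompact_closedBall 0 r)
    fun P _ => hV P).and eventually_mem_nhdsWithin).exists
  obtain ⟨P, hP⟩ := (hC.1 R hR).nonempty
  have hPr := (radius_le_of_mem_beachEllipse ((hC.1 R hR).subset hP).2.1).trans (hJr R hR)
  exact disjoint_left.1 hdisj (mem_closedBall_zero_iff.2 hPr) hP

theorem IsMovingSegment.eventually_subset_ball (hC : IsMovingSegment 𝒮 S J C)
    (hJ : J.OrdConnected) {d : ℝ} (hd : 0 < d)
    (hshell : ∀ᶠ R in 𝓝[J] r, Disjoint (Metric.closedBall V (d + d) \ Metric.ball V d) (C R))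
    (hV : ∃ᶠ p : HPlane × ℝ in 𝓝 V ×ˢ 𝓝[J] r, p.1 ∈ C p.2) :
    ∀ᶠ R in 𝓝[J] r, C R ⊆ Metric.ball V d := by
  have hfreq : ∃ᶠ R in 𝓝[J] r, (C R ∩ Metric.ball V d).Nonempty := by
    have hball : ∀ᶠ P in 𝓝 V, P ∈ Metric.ball V d := Metric.ball_mem_nhds V hd
    exact (tendsto_snd (f := 𝓝 V)).frequently
      ((hV.and_eventually (hball.prod_inl _)).mono fun p hp => ⟨p.1, hp⟩)
  have hmeets : ∀ᶠ R in 𝓝[J] r, (C R ∩ Metric.ball V d).Nonempty := by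
    refine hC.eventually_inter_nonempty hJ hd ?_ hfreq
    rw [thickening_ball hd hd]
    filter_upwards [hshell] with R hR ⟨P, hPC, hP⟩
    exact ⟨P, hPC, by_contra fun hPd =>
      disjoint_left.1 hR ⟨Metric.ball_subset_closedBall hP, hPd⟩ hPC⟩
  filter_upwards [hmeets, hshell, self_mem_nhdsWithin] with R hne hR hRJ
  refine (hC.1 R hRJ).isPreconnected.subset_left_of_subset_union Metric.isOpen_ball
    Metric.isClosed_closedBall.isOpen_compl (v := (Metric.closedBall V (d + d))ᶜ)
    (disjoint_compl_right_iff_subset.2 ?_) (fun P hP => ?_) hne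
  · exact Metric.ball_subset_closedBall.trans
      (Metric.closedBall_subset_closedBall (le_add_of_nonneg_right hd.le))
  · by_contra! hPd
    exact disjoint_left.1 hR ⟨not_notMem.1 fun h => hPd (.inr h), fun h => hPd (.inl h)⟩ hP

theorem IsMovingSegment.exists_shrinksTo_of_mem (hC : IsMovingSegment 𝒮 S J C)
    (hJ : J.OrdConnected) (hJr : ∀ R ∈ J, R ≤ r) (hS : S ∈ 𝒮) (hr : radius S < r)
    (hinactive : ¬ RemainsActiveBeyond 𝒮 S J C r) (hrJ : r ∈ J) :
    ∃ V ∈ incidentVertices 𝒮 S r, ShrinksTo C (𝓝[J] r) V := by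
  have hfreq {V : HPlane} (hV : V ∈ C r) :
      ∃ᶠ p : HPlane × ℝ in 𝓝 V ×ˢ 𝓝[J] r, p.1 ∈ C p.2 := by
    refine Filter.Frequently.filter_mono (f := pure (V, r)) (frequently_pure.2 hV) ?_
    exact prod_pure_pure.symm.trans_le (Filter.prod_mono (pure_le_nhds V) (pure_le_nhdsWithin hrJ))
  have hvertices : C r ⊆ incidentVertices 𝒮 S r := fun V hV =>
    hC.mem_incidentVertices hJ hJr hS hr hinactive (hfreq hV) fun _ => hV
  have hsingleton : (C r).Subsingleton := (hC.1 r hrJ).isPreconnected.isDiscrete_iff_subsingleton.1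
    ((isDiscrete_incidentVertices hr).mono hvertices)
  obtain ⟨V, hV⟩ := (hC.1 r hrJ).nonempty
  refine ⟨V, hvertices hV, fun δ hδ => ?_⟩
  filter_upwards [hC.2 r hrJ δ hδ] with R hR P hP
  obtain ⟨Q, hQ, hPQ⟩ := hR.1 P hP
  rwa [hsingleton hV hQ]

theorem IsMovingSegment.exists_shrinksTo_of_notMem [(𝓝[J] r).NeBot]
    (hC : IsMovingSegment 𝒮 S J C) (hJ : J.OrdConnected) (hJr : ∀ R ∈ J, R ≤ r) (hS : S ∈ 𝒮)
    (hr : radius S < r) (hinactive : ¬ RemainsActiveBeyond 𝒮 S J C r) (hrJ : r ∉ J) :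
    ∃ V ∈ incidentVertices 𝒮 S r, ShrinksTo C (𝓝[J] r) V := by
  have hvertex {P : HPlane} (hP : ∃ᶠ p : HPlane × ℝ in 𝓝 P ×ˢ 𝓝[J] r, p.1 ∈ C p.2) :
      P ∈ incidentVertices 𝒮 S r :=
    hC.mem_incidentVertices hJ hJr hS hr hinactive hP fun h => absurd h hrJ
  obtain ⟨V, hV⟩ := hC.exists_frequently_mem hJr
  refine ⟨V, hvertex hV, shrinksTo_of_eventually_subset_ball fun δ hδ => ?_⟩
  obtain ⟨η, hη, hisolated⟩ := Metric.eventually_nhds_iff_ball.1 (eventually_nhdsWithin_iff.1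
    (eventually_notMem_incidentVertices (𝒮 := 𝒮) hr (hvertex hV).1))
  obtain ⟨d, hd, hdmin⟩ : ∃ d, 0 < d ∧ d < min δ (η / 2) :=
    exists_between (lt_min hδ (half_pos hη))
  have hshell : ∀ᶠ R in 𝓝[J] r,
      Disjoint (Metric.closedBall V (d + d) \ Metric.ball V d) (C R) := by
    refine eventually_disjoint_of_isCompact
      ((isCompact_closedBall V (d + d)).diff Metric.isOpen_ball) fun P hP => ?_
    refine not_frequently.1 fun hfreq => hisolated P ?_ ?_ (hvertex hfreq)
    · exact Metric.closedBall_subset_ball (by linarith [hdmin.trans_le (min_le_right _ _)]) hP.1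
    · rintro rfl
      exact hP.2 (Metric.mem_ball_self hd)
  filter_upwards [hC.eventually_subset_ball hJ hd hshell hV] with R hR
  exact hR.trans (Metric.ball_subset_ball (hdmin.trans_le (min_le_left _ _)).le)

end Shrinking

section SiteEvent

variable {𝒮 : Finset HPlane} {S P : HPlane} {J : Set ℝ} {C : ℝ → Set HPlane} {r : ℝ}

theorem eq_of_mem_activePart_radius (h : P ∈ activePart 𝒮 S (radius S)) : P = S := by
  obtain ⟨hS, hP, hno⟩ := h
  by_contra hne
  have hPS : hdist P S = radius S - radius P := hP
  have hlt : radius P < radius S := by linarith [hdist_pos hne]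
  refine hno ⟨S, hS, S, ?_, ?_, hlt⟩
  · exact (hdist_self S).trans (sub_self _).symm
  · rw [← hdist_eq_abs_radius_sub_iff, hPS, abs_sub_comm, abs_of_pos (sub_pos.2 hlt)]

theorem polar_angle_mem_beachEllipse {R : ℝ} (hR : radius S ≤ R) :
    polar ((R + radius S) / 2) (angle S) ∈ beachEllipse S R := by
  have hx : 0 ≤ (R + radius S) / 2 := by linarith [radius_nonneg S]
  change hdist _ _ = _
  rw [hdist_comm, hdist_eq_abs_radius_sub_iff.2 (sameAngle_polar hx S), radius_polar hx,
    abs_of_nonpos (by linarith)]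
  ring

/-- The midpoint between `S` and the sweep circle tends to `S` as `R` decreases to `radius S`,
so that `S` becomes its only closest site. -/
theorem eventually_polar_angle_mem_activePart (hS : S ∈ 𝒮) :
    ∀ᶠ R in 𝓝[>] radius S, polar ((R + radius S) / 2) (angle S) ∈ activePart 𝒮 S R := by
  have hcont : Continuous fun R => polar ((R + radius S) / 2) (angle S) :=
    continuous_polar.comp (f := fun R => ((R + radius S) / 2, angle S)) (by fun_prop)
  have hcenter : polar ((radius S + radius S) / 2) (angle S) = S := by
    rw [add_self_div_two, polar_radius_angle]
  have hclose : ∀ᶠ R in 𝓝 (radius S), ∀ T ∈ 𝒮, T ≠ S →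
      hdist (polar ((R + radius S) / 2) (angle S)) S <
        hdist (polar ((R + radius S) / 2) (angle S)) T := by
    simp only [Finset.eventually_all, eventually_imp_distrib_left]
    intro T _ hTS
    refine ((continuous_hdist_left S).comp hcont).continuousAt.eventually_lt
      ((continuous_hdist_left T).comp hcont).continuousAt ?_
    simp only [Function.comp_apply, hcenter, hdist_self]
    exact hdist_pos hTS.symm
  filter_upwards [eventually_nhdsWithin_of_eventually_nhds hclose, self_mem_nhdsWithin]
    with R hclose (hR : radius S < R)
  refine (mem_activePart_iff hR).2 ⟨polar_angle_mem_beachEllipse hR.le, ⟨hS, fun T hT => ?_⟩,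
    fun T hT hTR => hclose T hT fun h => hR.ne (h ▸ hTR)⟩
  rcases eq_or_ne T S with rfl | hTS
  · rfl
  · exact (hclose T hT hTS).le

theorem IsMovingSegment.remainsActiveBeyond_radius (hC : IsMovingSegment 𝒮 S J C)
    (hJ : radius S ∈ J) (hJS : ∀ R ∈ J, R ≤ radius S) :
    RemainsActiveBeyond 𝒮 S J C (radius S) := by
  obtain ⟨P, hP⟩ := (hC.1 _ hJ).nonempty
  have hPactive := (hC.1 _ hJ).subset hP
  obtain rfl := eq_of_mem_activePart_radius hPactive
  obtain ⟨R, hR, hactive⟩ :=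
    mem_nhdsGT_iff_exists_Ioc_subset.1 (eventually_polar_angle_mem_activePart hPactive.1.1)
  have hcenter : polar ((radius P + radius P) / 2) (angle P) = P := by
    rw [add_self_div_two, polar_radius_angle]
  refine ⟨radius P, hJ, R - radius P, sub_pos.2 hR,
    fun R => polar ((R + radius P) / 2) (angle P), ?_, fun R hR hPR => ?_, ?_⟩
  · exact (continuous_polar.comp (f := fun R => ((R + radius P) / 2, angle P))
      (by fun_prop)).continuousOn
  · obtain rfl := (hJS R hR).antisymm hPR
    simpa only [hcenter] using hP
  · rw [add_sub_cancel]
    rintro R' ⟨hPR', hR'⟩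
    rcases hPR'.eq_or_lt with rfl | hPR'
    · simpa only [hcenter] using hPactive
    · exact hactive ⟨hPR', hR'⟩

theorem BecomesInactiveAt.exists_shrinksTo (h : BecomesInactiveAt 𝒮 S J C r) :
    ∃ V ∈ incidentVertices 𝒮 S r, ShrinksTo C (𝓝[J] r) V := by
  obtain ⟨⟨R₀, hR₀⟩, hJ, hlub, hC, hinactive⟩ := h
  have hJr : ∀ R ∈ J, R ≤ r := fun R hR => hlub.1 hR
  obtain ⟨P, hP⟩ := (hC.1 R₀ hR₀).nonempty
  obtain ⟨hS, hSR₀⟩ := ((hC.1 R₀ hR₀).subset hP).1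
  rcases (hSR₀.trans (hJr R₀ hR₀)).eq_or_lt with rfl | hr
  · exact absurd (hC.remainsActiveBeyond_radius ((hJr R₀ hR₀).antisymm hSR₀ ▸ hR₀) hJr) hinactive
  by_cases hrJ : r ∈ J
  · exact hC.exists_shrinksTo_of_mem hJ hJr hS hr hinactive hrJ
  · have := hlub.nhdsWithin_neBot ⟨R₀, hR₀⟩
    exact hC.exists_shrinksTo_of_notMem hJ hJr hS hr hinactive hrJ

end SiteEvent

end HyperbolicSweep

theorem mainTheorem4 (𝒮 : Finset HPlane) :
    -- an active segment becomes inactive only through a (true) circle event: it shrinks to a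
    -- Voronoi vertex `V` incident to its site when the sweep circle reaches the far point of `V`
    (∀ (S : HPlane) (J : Set ℝ) (C : ℝ → Set HPlane) (r : ℝ), BecomesInactiveAt 𝒮 S J C r →
      ∃ V V' : HPlane, IsVoronoiVertex 𝒮 V ∧ IsClosestSite 𝒮 V S ∧
        IsFarPoint 𝒮 V V' ∧ radius V' = r ∧
        ∀ δ > 0, ∀ᶠ R in 𝓝[J] r, ∀ P ∈ C R, hdist P V < δ) ∧
    -- no intersection leaves the beach curve strictly between two consecutive events
    (∀ a b : EReal, ConsecutiveEvents 𝒮 a b → ∀ r : ℝ, a < (r : EReal) → (r : EReal) < b →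
      ∀ S ∈ seenSites 𝒮 r, ∀ T ∈ seenSites 𝒮 r, S ≠ T →
        ∀ I : ℝ → HPlane, ¬ LeavesBeachCurveAt 𝒮 S T I r) := by
  refine ⟨fun S J C r h => ?_, fun a b hab r har hrb S hS T hT hST I => ?_⟩
  · obtain ⟨V, ⟨hVE, hVS, hV⟩, hshrinks⟩ := h.exists_shrinksTo
    obtain ⟨V', hV', hr⟩ := exists_isFarPoint hVE hVS
    exact ⟨V, V', hV, hVS, hV', hr, hshrinks⟩
  · obtain ⟨hsite, hcircle⟩ := hab.notMem_siteEvents_and_circleEvents har hrb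
    exact not_leavesBeachCurveAt hsite hcircle hS hT hST I
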